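/- Let $n\ge 2$ and let $\Omega\subset\mathbb R^n$ be a bounded open set. Let $1<p_k<q_k<\infty$ for $k=1,\dots,n$, and put $$p_m=\max_k p_k,\qquad \frac1{\overline p}=\frac1n\sum_{k=1}^n\frac1{p_k},\qquad \tau=\max_k\frac{q_k}{p_k}.$$ Assume $\overline p<n$ and put $\overline p^*=\frac{n\overline p}{n-\overline p}$. For exponents $r_k>1$ let $W^{1,(r_k)}(\Omega)$ (respectively $W^{1,(r_k)}_0(\Omega)$) be the set of $v\in W^{1,1}(\Omega)$ (respectively $v\in W^{1,1}_0(\Omega)$, the closure of $C_c^\infty(\Omega)$ in $W^{1,1}(\Omega)$) such that the weak derivative $D_kv$ belongs to $L^{r_k}(\Omega)$ for every $k$. For $t>0$ let $L^t_{weak}(\Omega)$ be the set of measurable functions $g$ on $\Omega$ for which there is a constant $c>0$ with $|\{x\in\Omega:|g(x)|>s\}|\le c\,s^{-t}$ for all $s>0$. Let $a_i:\Omega\times\mathbb R^n\to\mathbb R$, $i=1,\dots,n$, be Carathéodory functions (measurable in $x$ for every $z$, continuous in $z$ for almost every $x$). Suppose that for some constants $c_1,\tilde\nu\in(0,\infty)$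 and some $0\le h\in L^\tau(\Omega)$, for almost every $x\in\Omega$, all $z,\tilde z\in\mathbb R^n$ and all $i=1,\dots,n$, $$|a_i(x,z)|\le c_1\Big(h(x)+\sum_{j=1}^n|z_j|^{p_j}\Big)^{1-1/p_i},$$ $$\tilde\nu\sum_{j=1}^n|z_j-\tilde z_j|^{p_j}\le\sum_{j=1}^n\big(a_j(x,z)-a_j(x,\tilde z)\big)(z_j-\tilde z_j).$$ Let $\theta\in W^{1,(q_k)}(\Omega)$, and let $\psi:\Omega\to[-\infty,+\infty]$ be any function such that $\theta_*=\max\{\psi,\theta\}\in\theta+W^{1,(q_k)}_0(\Omega)$. Let $b$ be any number with $$0<b\le\min_{j}\Big(1-\frac{p_j}{q_j}\Big)\min_{i}\Big(1-\frac1{p_i}\Big)\qquad\text{and}\qquad b<\frac{p_m-1}{p_m}\,\frac{\overline p}{\overline p^*},$$ let $f^i\in L^{p_i/(p_i-1-bp_i)}(\Omega)$ for $i=1,\dots,n$, and put $$t=\frac{\overline p^*}{1-\frac{b\,\overline p^*}{\overline p}\,\frac{p_m}{p_m-1}}.$$ Let $\mathcal K=\{v\in W^{1,(p_k)}(\Omega):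 v\ge\psi\text{ a.e. in }\Omega,\ v-\theta\in W^{1,(p_k)}_0(\Omega)\}$. A solution to the obstacle problem is a function $u\in\mathcal K$ such that, for all $v\in\mathcal K$, $$\int_\Omega\sum_{i=1}^n a_i(x,Du(x))\,(D_iv(x)-D_iu(x))\,dx\ \ge\ \int_\Omega\sum_{i=1}^n f^i(x)\,(D_iv(x)-D_iu(x))\,dx.$$ Then $t>\overline p^*$, and every solution $u$ to the obstacle problem satisfies $u-\theta_*\in L^t_{weak}(\Omega)$. -/

import Mathlib

open MeasureTheory Filter Topology

namespace AnisoObstacle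

/- Points of `ℝⁿ` are functions `Fin n → ℝ`. Only notions that do not depend on the choice of a norm
are used (open sets, bounded sets, smooth functions, Lebesgue measure), and `volume` on
`Fin n → ℝ` is the `n`-dimensional Lebesgue measure. Functions on `Ω` are represented by functions
on `ℝⁿ` of which only the values on `Ω` matter. -/

/-- The classical partial derivative `∂φ/∂x_k`. -/
noncomputable def partialDeriv {n : ℕ} (k : Fin n) (φ : (Fin n → ℝ) → ℝ) (x : Fin n → ℝ) : ℝ :=
  fderiv ℝ φ x (Pi.single k 1)

/-- `φ ∈ C_c^∞(Ω)`. -/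
structure IsTestFunction {n : ℕ} (Ω : Set (Fin n → ℝ)) (φ : (Fin n → ℝ) → ℝ) : Prop where
  smooth : ContDiff ℝ ((⊤ : ℕ∞) : WithTop ℕ∞) φ
  compact_support : HasCompactSupport φ
  support_subset : tsupport φ ⊆ Ω

/-- `G = (G_1, …, G_n)` is the weak gradient of `v` on `Ω`. -/
structure IsWeakGradient {n : ℕ} (Ω : Set (Fin n → ℝ)) (v : (Fin n → ℝ) → ℝ)
    (G : Fin n → (Fin n → ℝ) → ℝ) : Prop where
  locallyIntegrable : LocallyIntegrableOn v Ω
  locallyIntegrable_grad : ∀ k, LocallyIntegrableOn (G k) Ω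
  integral_eq : ∀ k, ∀ φ : (Fin n → ℝ) → ℝ, IsTestFunction Ω φ →
    ∫ x in Ω, v x * partialDeriv k φ x = - ∫ x in Ω, G k x * φ x

/-- `v ∈ W^{1,(r_k)}(Ω)`: `v ∈ W^{1,1}(Ω)` and `D_k v ∈ L^{r_k}(Ω)` for every `k`. -/
def MemW {n : ℕ} (Ω : Set (Fin n → ℝ)) (r : Fin n → ℝ) (v : (Fin n → ℝ) → ℝ) : Prop :=
  MemLp v 1 (volume.restrict Ω) ∧
  ∃ G : Fin n → (Fin n → ℝ) → ℝ, IsWeakGradient Ω v G ∧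
    (∀ k, MemLp (G k) 1 (volume.restrict Ω)) ∧
    (∀ k, MemLp (G k) (ENNReal.ofReal (r k)) (volume.restrict Ω))

/-- `v ∈ W_0^{1,(r_k)}(Ω)`: `v ∈ W_0^{1,1}(Ω)`, that is, `v` is a limit of functions in `C_c^∞(Ω)`
in the norm of `W^{1,1}(Ω)`, and `D_k v ∈ L^{r_k}(Ω)` for every `k`. -/
def MemW0 {n : ℕ} (Ω : Set (Fin n → ℝ)) (r : Fin n → ℝ) (v : (Fin n → ℝ) → ℝ) : Prop :=
  MemLp v 1 (volume.restrict Ω) ∧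
  ∃ G : Fin n → (Fin n → ℝ) → ℝ, IsWeakGradient Ω v G ∧
    (∀ k, MemLp (G k) 1 (volume.restrict Ω)) ∧
    (∃ φ : ℕ → (Fin n → ℝ) → ℝ, (∀ j, IsTestFunction Ω (φ j)) ∧
      Tendsto (fun j => eLpNorm (fun x => v x - φ j x) 1 (volume.restrict Ω)) atTop (𝓝 0) ∧
      ∀ k, Tendsto (fun j => eLpNorm (fun x => G k x - partialDeriv k (φ j) x) 1
        (volume.restrict Ω)) atTop (𝓝 0)) ∧
    (∀ k, MemLp (G k) (ENNReal.ofReal (r k)) (volume.restrict Ω))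

/-- The class `K_{ψ,θ}^{(p_k)}(Ω)` of admissible functions for the obstacle `ψ` and the boundary
datum `θ`. -/
def obstacleClass {n : ℕ} (Ω : Set (Fin n → ℝ)) (p : Fin n → ℝ) (ψ : (Fin n → ℝ) → EReal)
    (θ : (Fin n → ℝ) → ℝ) : Set ((Fin n → ℝ) → ℝ) :=
  {v | MemW Ω p v ∧ (∀ᵐ x ∂(volume.restrict Ω), ψ x ≤ (v x : EReal)) ∧
    MemW0 Ω p (fun x => v x - θ x)}

/-- `u` is a solution to the `K_{ψ,θ}^{(p_k)}`-obstacle problem for the equation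
`∑ D_i (a_i(x, Du)) = ∑ D_i f^i`. Weak gradients are unique up to null sets, so that the choice of
`Du` and `Dv` does not matter. -/
def IsObstacleSolution {n : ℕ} (Ω : Set (Fin n → ℝ)) (p : Fin n → ℝ)
    (ψ : (Fin n → ℝ) → EReal) (θ : (Fin n → ℝ) → ℝ)
    (a : Fin n → (Fin n → ℝ) → (Fin n → ℝ) → ℝ) (f : Fin n → (Fin n → ℝ) → ℝ)
    (u : (Fin n → ℝ) → ℝ) : Prop :=
  u ∈ obstacleClass Ω p ψ θ ∧
  ∀ v ∈ obstacleClass Ω p ψ θ, ∀ Du Dv : Fin n → (Fin n → ℝ) → ℝ,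
    IsWeakGradient Ω u Du → IsWeakGradient Ω v Dv →
    ∫ x in Ω, ∑ i, f i x * (Dv i x - Du i x) ≤
      ∫ x in Ω, ∑ i, a i x (fun j => Du j x) * (Dv i x - Du i x)

/-- `a : Ω × ℝⁿ → ℝ` is a Carathéodory function. -/
structure IsCaratheodory {n : ℕ} (Ω : Set (Fin n → ℝ))
    (a : (Fin n → ℝ) → (Fin n → ℝ) → ℝ) : Prop where
  measurable : ∀ z, AEStronglyMeasurable (fun x => a x z) (volume.restrict Ω)
  continuous : ∀ᵐ x ∂(volume.restrict Ω), Continuous (fun z => a x z)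

/-- The weak Lebesgue (Marcinkiewicz) space: `g ∈ L^t_weak(Ω)`. -/
def MemWeakLp {n : ℕ} (Ω : Set (Fin n → ℝ)) (t : ℝ) (g : (Fin n → ℝ) → ℝ) : Prop :=
  AEStronglyMeasurable g (volume.restrict Ω) ∧
  ∃ c : ℝ, 0 < c ∧ ∀ s : ℝ, 0 < s →
    volume {x | x ∈ Ω ∧ s < |g x|} ≤ ENNReal.ofReal (c / s ^ t)

/-- The harmonic mean `p̄` of `p_1, …, p_n`, that is, `1 / p̄ = (1 / n) ∑ 1 / p_k`. -/
noncomputable def harmonicMean {n : ℕ} (p : Fin n → ℝ) : ℝ :=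
  ((1 / (n : ℝ)) * ∑ k, 1 / p k)⁻¹

/-- The Sobolev conjugate `r* = n r / (n - r)` of an exponent `r < n`. -/
noncomputable def sobolevConj (n : ℕ) (r : ℝ) : ℝ :=
  n * r / (n - r)

end AnisoObstacle

/-! Put `w = u - θ_*` and `P = ∑ 1 / p_k`, so that `p̄ = n / P`, `p̄* = n / (P - 1)` and `p̄* / p̄ =
P / (P - 1)`. The theorem is a decay estimate for `|{|w| > L}|`, obtained by comparing the levels
`L` and `2L`.

For a smooth nondecreasing `H` that vanishes on `[-L, L]` and has modulus `L` outside `(-2L, 2L)`,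
the function `u - H(w)` is admissible. Testing with it
(`IsObstacleSolution.integral_nonneg_of_cutoff`) and using monotonicity between `Du` and `Dθ_*`
followed by Young (`exists_energy_estimate`) bounds `∫ H'(w) ∑ |D_i w|^{p_i}` by `∫ H'(w) g`. Here
`g` is a combination of the powers `|f^i - a_i(x, Dθ_*)|^{p_i'}`. It involves only the data, and
lies in `L^{1/(1-β)}` with `β = b p_m / (p_m - 1)`; that all the integrability exponents suffice for
this is `exponent_bounds`. Since `H'(w)` vanishes where `|w| ≤ L`, Hölder
(`integral_mul_le_measure_rpow`) gives a bound by `C |{|w| > L}|^β`.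

Troisi's inequality (`exists_anisotropic_sobolev`), applied to the bounded function `H(w)`, and
Chebyshev then give `L^{p̄*} |{|w| > 2L}| ≤ C |{|w| > L}|^γ` with `γ = β p̄* / p̄`. The strict upper
bound on `b` says that `γ < 1`. Iterating over dyadic levels (`exists_le_div_rpow_of_dyadic`) gives
decay of order `t = p̄* / (1 - γ)`, which exceeds `p̄*` because `γ > 0`.

The smooth `H` takes the place of the usual truncation, so only the smooth chain rule in `W_0^{1,1}`
is used, proved by composing the approximating test functions with `H`. -/

namespace AnisoObstacle

/-! ### Products and `L¹` convergence -/

/-- If `α_j → α` almost everywhere, boundedly, and `D_j → D` in `L¹`, then `α_j D_j → α D`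
in `L¹`. -/
lemma tendsto_eLpNorm_one_mul {X : Type*} [MeasurableSpace X] {μ : Measure X}
    {α : X → ℝ} {αj : ℕ → X → ℝ} {D : X → ℝ} {Dj : ℕ → X → ℝ} {M : ℝ}
    (hα : ∀ j, AEStronglyMeasurable (αj j) μ) (hM : ∀ j x, |αj j x| ≤ M)
    (hαt : ∀ᵐ x ∂μ, Tendsto (fun j => αj j x) atTop (𝓝 (α x)))
    (hD : MemLp D 1 μ) (hDj : ∀ j, AEStronglyMeasurable (Dj j) μ)
    (hDt : Tendsto (fun j => eLpNorm (fun x => D x - Dj j x) 1 μ) atTop (𝓝 0)) :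
    Tendsto (fun j => eLpNorm (fun x => α x * D x - αj j x * Dj j x) 1 μ) atTop (𝓝 0) := by
  have hαm : AEStronglyMeasurable α μ := aestronglyMeasurable_of_tendsto_ae _ hα hαt
  -- The difference is `α_j (D - D_j) + (α - α_j) D`. The bound `M` controls the first term;
  -- dominated convergence with majorant `2M |D|` controls the second.
  have h1 : Tendsto (fun j => eLpNorm (fun x => αj j x * (D x - Dj j x)) 1 μ) atTop (𝓝 0) := by
    have hb : Tendsto (fun j => ENNReal.ofReal M * eLpNorm (fun x => D x - Dj j x) 1 μ) atTop
        (𝓝 0) := by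
      simpa using ENNReal.Tendsto.const_mul hDt (Or.inr ENNReal.ofReal_ne_top)
    refine tendsto_of_tendsto_of_tendsto_of_le_of_le tendsto_const_nhds hb
      (fun _ => zero_le) fun j => ?_
    refine eLpNorm_le_mul_eLpNorm_of_ae_le_mul (Eventually.of_forall fun x => ?_) 1
    rw [norm_mul]
    exact mul_le_mul_of_nonneg_right (hM j x) (norm_nonneg _)
  have h2 : Tendsto (fun j => eLpNorm (fun x => (α x - αj j x) * D x) 1 μ) atTop (𝓝 0) := by
    simp only [eLpNorm_one_eq_lintegral_enorm]
    have : Tendsto (fun j => ∫⁻ x, ‖(α x - αj j x) * D x‖ₑ ∂μ) atTop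
        (𝓝 (∫⁻ _, (0 : ENNReal) ∂μ)) := by
      refine tendsto_lintegral_of_dominated_convergence' (fun x => ENNReal.ofReal (2 * M) * ‖D x‖ₑ)
        (fun j => ((hαm.sub (hα j)).mul hD.1).enorm) (fun j => ?_) ?_ ?_
      · filter_upwards [hαt] with x hx
        have hαx : |α x| ≤ M := le_of_tendsto hx.abs (Eventually.of_forall fun j => hM j x)
        rw [enorm_mul]
        gcongr
        rw [Real.enorm_eq_ofReal_abs]
        refine ENNReal.ofReal_le_ofReal ((abs_sub _ _).trans ?_)
        linarith [hM j x]
      · have := hD.2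
        rw [eLpNorm_one_eq_lintegral_enorm] at this
        rw [lintegral_const_mul' _ _ ENNReal.ofReal_ne_top]
        exact ENNReal.mul_ne_top ENNReal.ofReal_ne_top this.ne
      · filter_upwards [hαt] with x hx
        have : Tendsto (fun j => (α x - αj j x) * D x) atTop (𝓝 0) := by
          simpa using ((tendsto_const_nhds (x := α x)).sub hx).mul_const (D x)
        simpa using this.enorm
    simpa using this
  have h3 := h1.add h2
  rw [add_zero] at h3
  refine tendsto_of_tendsto_of_tendsto_of_le_of_le tendsto_const_nhds h3
    (fun _ => zero_le) fun j => ?_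
  refine le_trans (le_of_eq ?_) (eLpNorm_add_le ((hα j).mul (hD.1.sub (hDj j)))
    ((hαm.sub (hα j)).mul hD.1) le_rfl)
  congr 1
  ext x
  simp only [Pi.add_apply]
  change _ = αj j x * (D x - Dj j x) + (α x - αj j x) * D x
  ring

/-- Convergence in `L¹` is preserved by integration against a bounded function. -/
lemma tendsto_integral_mul_of_eLpNorm {X : Type*} [MeasurableSpace X] {μ : Measure X}
    {v η : X → ℝ} {vj : ℕ → X → ℝ} {M : ℝ} (hv : MemLp v 1 μ) (hvj : ∀ j, MemLp (vj j) 1 μ)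
    (hη : AEStronglyMeasurable η μ) (hM : ∀ x, |η x| ≤ M)
    (ht : Tendsto (fun j => eLpNorm (fun x => v x - vj j x) 1 μ) atTop (𝓝 0)) :
    Tendsto (fun j => ∫ x, vj j x * η x ∂μ) atTop (𝓝 (∫ x, v x * η x ∂μ)) := by
  have key := tendsto_eLpNorm_one_mul (αj := fun _ => η) (fun _ => hη) (fun _ => hM)
    (Eventually.of_forall fun _ => tendsto_const_nhds) hv (fun j => (hvj j).1) ht
  refine tendsto_integral_of_L1' _ ?_ (Eventually.of_forall fun j => ?_) ?_
  · exact hv.1.mul hη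
  · exact (memLp_one_iff_integrable.1 (hvj j)).mul_bdd (c := M) hη (Eventually.of_forall hM)
  · refine key.congr fun j => ?_
    rw [← eLpNorm_neg]
    congr 1
    ext x
    simp only [Pi.neg_apply, Pi.sub_apply]
    ring

/-! ### Calculus of test functions -/

variable {n : ℕ} {Ω : Set (Fin n → ℝ)}

namespace IsTestFunction

variable {φ η : (Fin n → ℝ) → ℝ}

lemma contDiff_one (hφ : IsTestFunction Ω φ) : ContDiff ℝ 1 φ :=
  hφ.smooth.of_le (by exact_mod_cast le_top)

lemma differentiable (hφ : IsTestFunction Ω φ) : Differentiable ℝ φ :=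
  hφ.contDiff_one.differentiable one_ne_zero

lemma continuous_partialDeriv (hφ : IsTestFunction Ω φ) (k : Fin n) :
    Continuous (partialDeriv k φ) :=
  (hφ.contDiff_one.continuous_fderiv one_ne_zero).clm_apply continuous_const

lemma hasCompactSupport_partialDeriv (hφ : IsTestFunction Ω φ) (k : Fin n) :
    HasCompactSupport (partialDeriv k φ) :=
  hφ.compact_support.fderiv_apply ℝ _

lemma eq_zero (hφ : IsTestFunction Ω φ) {x : Fin n → ℝ} (hx : x ∉ Ω) : φ x = 0 :=
  image_eq_zero_of_notMem_tsupport fun h => hx (hφ.support_subset h)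

lemma partialDeriv_eq_zero (hφ : IsTestFunction Ω φ) (k : Fin n) {x : Fin n → ℝ} (hx : x ∉ Ω) :
    partialDeriv k φ x = 0 := by
  have : fderiv ℝ φ x = 0 := image_eq_zero_of_notMem_tsupport fun h =>
    hx (hφ.support_subset (tsupport_fderiv_subset ℝ h))
  simp [partialDeriv, this]

lemma integrable (hφ : IsTestFunction Ω φ) : Integrable φ :=
  hφ.smooth.continuous.integrable_of_hasCompactSupport hφ.compact_support

lemma memLp (hφ : IsTestFunction Ω φ) : MemLp φ 1 (volume.restrict Ω) :=
  memLp_one_iff_integrable.2 hφ.integrable.restrict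

lemma memLp_partialDeriv (hφ : IsTestFunction Ω φ) (k : Fin n) :
    MemLp (partialDeriv k φ) 1 (volume.restrict Ω) :=
  memLp_one_iff_integrable.2 ((hφ.continuous_partialDeriv k).integrable_of_hasCompactSupport
    (hφ.hasCompactSupport_partialDeriv k)).restrict

lemma sub (hφ : IsTestFunction Ω φ) (hη : IsTestFunction Ω η) :
    IsTestFunction Ω (fun x => φ x - η x) where
  smooth := hφ.smooth.sub hη.smooth
  compact_support := hφ.compact_support.sub hη.compact_support
  support_subset := (tsupport_sub φ η).trans (Set.union_subset hφ.support_subset hη.support_subset)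

lemma partialDeriv_sub (hφ : IsTestFunction Ω φ) (hη : IsTestFunction Ω η) (k : Fin n)
    (x : Fin n → ℝ) :
    partialDeriv k (fun x => φ x - η x) x = partialDeriv k φ x - partialDeriv k η x := by
  simp [partialDeriv, fderiv_fun_sub (hφ.differentiable x) (hη.differentiable x)]

lemma comp (hφ : IsTestFunction Ω φ) {H : ℝ → ℝ} (hH : ContDiff ℝ ((⊤ : ℕ∞) : WithTop ℕ∞) H)
    (hH0 : H 0 = 0) : IsTestFunction Ω (fun x => H (φ x)) where
  smooth := hH.comp hφ.smooth
  compact_support := hφ.compact_support.comp_left hH0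
  support_subset := (closure_mono (Function.support_comp_subset hH0 φ)).trans hφ.support_subset

lemma partialDeriv_comp (hφ : IsTestFunction Ω φ) {H : ℝ → ℝ} (hH : Differentiable ℝ H)
    (k : Fin n) (x : Fin n → ℝ) :
    partialDeriv k (fun x => H (φ x)) x = deriv H (φ x) * partialDeriv k φ x := by
  have := ((hH (φ x)).hasDerivAt.comp_hasFDerivAt x (hφ.differentiable x).hasFDerivAt).fderiv
  simp only [partialDeriv]
  change fderiv ℝ (H ∘ φ) x _ = _
  rw [this]
  simp

/-- Both integrands vanish off `Ω`, so the integrals extend to `ℝⁿ`, where compact support leaves no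
boundary term. No regularity of `Ω` is involved. -/
lemma integral_mul_partialDeriv (hφ : IsTestFunction Ω φ) (hη : IsTestFunction Ω η) (k : Fin n) :
    ∫ x in Ω, φ x * partialDeriv k η x = - ∫ x in Ω, partialDeriv k φ x * η x := by
  rw [setIntegral_eq_integral_of_forall_compl_eq_zero fun x hx => by simp [hφ.eq_zero hx],
    setIntegral_eq_integral_of_forall_compl_eq_zero fun x hx => by simp [hη.eq_zero hx]]
  refine integral_mul_fderiv_eq_neg_fderiv_mul_of_integrable ?_ ?_ ?_
    (fun x _ => hφ.differentiable x) (fun x _ => hη.differentiable x)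
  · exact ((hφ.continuous_partialDeriv k).mul hη.smooth.continuous).integrable_of_hasCompactSupport
      hη.compact_support.mul_left
  · exact (hφ.smooth.continuous.mul (hη.continuous_partialDeriv k)).integrable_of_hasCompactSupport
      hφ.compact_support.mul_right
  · exact (hφ.smooth.continuous.mul hη.smooth.continuous).integrable_of_hasCompactSupport
      hφ.compact_support.mul_right

end IsTestFunction

/-! ### The space `W_0^{1,1}` and its smooth chain rule -/

/-- `φ_j → v` in `W^{1,1}(Ω)` with gradients converging to `G`. -/
def TendstoW11 (Ω : Set (Fin n → ℝ)) (φ : ℕ → (Fin n → ℝ) → ℝ) (v : (Fin n → ℝ) → ℝ)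
    (G : Fin n → (Fin n → ℝ) → ℝ) : Prop :=
  Tendsto (fun j => eLpNorm (fun x => v x - φ j x) 1 (volume.restrict Ω)) atTop (𝓝 0) ∧
    ∀ k, Tendsto (fun j => eLpNorm (fun x => G k x - partialDeriv k (φ j) x) 1
      (volume.restrict Ω)) atTop (𝓝 0)

/-- `v ∈ W_0^{1,1}(Ω)` with gradient `G`. -/
structure IsW0Gradient (Ω : Set (Fin n → ℝ)) (v : (Fin n → ℝ) → ℝ)
    (G : Fin n → (Fin n → ℝ) → ℝ) : Prop where
  memLp : MemLp v 1 (volume.restrict Ω)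
  memLp_grad : ∀ k, MemLp (G k) 1 (volume.restrict Ω)
  approx : ∃ φ : ℕ → (Fin n → ℝ) → ℝ, (∀ j, IsTestFunction Ω (φ j)) ∧ TendstoW11 Ω φ v G

lemma _root_.MeasureTheory.MemLp.locallyIntegrableOn_of_one {v : (Fin n → ℝ) → ℝ}
    (hv : MemLp v 1 (volume.restrict Ω)) : LocallyIntegrableOn v Ω :=
  IntegrableOn.locallyIntegrableOn (memLp_one_iff_integrable.1 hv)

namespace IsW0Gradient

variable {v v' : (Fin n → ℝ) → ℝ} {G G' : Fin n → (Fin n → ℝ) → ℝ}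

/-- Integration by parts for the approximants passes to the limit, because a test function and its
partial derivatives are bounded. -/
lemma isWeakGradient (h : IsW0Gradient Ω v G) : IsWeakGradient Ω v G where
  locallyIntegrable := h.memLp.locallyIntegrableOn_of_one
  locallyIntegrable_grad k := (h.memLp_grad k).locallyIntegrableOn_of_one
  integral_eq k η hη := by
    obtain ⟨φ, hφ, ht, htG⟩ := h.approx
    obtain ⟨C, hC⟩ := hη.compact_support.exists_bound_of_continuous hη.smooth.continuous
    obtain ⟨C', hC'⟩ := (hη.hasCompactSupport_partialDeriv k).exists_bound_of_continuous
      (hη.continuous_partialDeriv k)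
    have h1 := tendsto_integral_mul_of_eLpNorm h.memLp (fun j => (hφ j).memLp)
      (hη.continuous_partialDeriv k).aestronglyMeasurable hC' ht
    have h2 := tendsto_integral_mul_of_eLpNorm (h.memLp_grad k)
      (fun j => (hφ j).memLp_partialDeriv k) hη.smooth.continuous.aestronglyMeasurable hC (htG k)
    refine tendsto_nhds_unique h1 (h2.neg.congr fun j => ?_)
    exact ((hφ j).integral_mul_partialDeriv hη k).symm

lemma sub (h : IsW0Gradient Ω v G) (h' : IsW0Gradient Ω v' G') :
    IsW0Gradient Ω (fun x => v x - v' x) (fun k x => G k x - G' k x) where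
  memLp := h.memLp.sub h'.memLp
  memLp_grad k := (h.memLp_grad k).sub (h'.memLp_grad k)
  approx := by
    obtain ⟨φ, hφ, ht, htG⟩ := h.approx
    obtain ⟨φ', hφ', ht', htG'⟩ := h'.approx
    refine ⟨fun j x => φ j x - φ' j x, fun j => (hφ j).sub (hφ' j), ?_, fun k => ?_⟩
    · have hs := ht.add ht'
      rw [add_zero] at hs
      refine tendsto_of_tendsto_of_tendsto_of_le_of_le tendsto_const_nhds hs
        (fun _ => zero_le) fun j => ?_
      refine le_trans (le_of_eq ?_) (eLpNorm_sub_le (h.memLp.sub (hφ j).memLp).1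
        (h'.memLp.sub (hφ' j).memLp).1 le_rfl)
      congr 1
      ext x
      simp only [Pi.sub_apply]
      ring
    · have hs := (htG k).add (htG' k)
      rw [add_zero] at hs
      refine tendsto_of_tendsto_of_tendsto_of_le_of_le tendsto_const_nhds hs
        (fun _ => zero_le) fun j => ?_
      refine le_trans (le_of_eq ?_)
        (eLpNorm_sub_le ((h.memLp_grad k).sub ((hφ j).memLp_partialDeriv k)).1
        ((h'.memLp_grad k).sub ((hφ' j).memLp_partialDeriv k)).1 le_rfl)
      congr 1
      ext x
      simp only [Pi.sub_apply, (hφ j).partialDeriv_sub (hφ' j)]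
      ring

/-- `L¹` convergence implies convergence in measure, hence almost everywhere along a subsequence.
Pointwise convergence is what the chain rule and Fatou's lemma need later. -/
lemma exists_ae_approx (h : IsW0Gradient Ω v G) : ∃ φ : ℕ → (Fin n → ℝ) → ℝ,
    (∀ j, IsTestFunction Ω (φ j)) ∧
    (∀ᵐ x ∂(volume.restrict Ω), Tendsto (fun j => φ j x) atTop (𝓝 (v x))) ∧
    TendstoW11 Ω φ v G := by
  obtain ⟨φ, hφ, ht, htG⟩ := h.approx
  have hm : TendstoInMeasure (volume.restrict Ω) φ atTop v := by
    refine tendstoInMeasure_of_tendsto_eLpNorm one_ne_zero (fun j => (hφ j).memLp.1) h.memLp.1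
      (ht.congr fun j => ?_)
    rw [← eLpNorm_neg]
    congr 1
    ext x
    simp
  obtain ⟨ns, hns, hae⟩ := hm.exists_seq_tendsto_ae
  exact ⟨fun j => φ (ns j), fun j => hφ _, hae, ht.comp hns.tendsto_atTop,
    fun k => (htG k).comp hns.tendsto_atTop⟩

/-- The chain rule in `W_0^{1,1}(Ω)`, with the approximating sequence. -/
lemma exists_comp_approx (h : IsW0Gradient Ω v G) {H : ℝ → ℝ}
    (hH : ContDiff ℝ ((⊤ : ℕ∞) : WithTop ℕ∞) H) (hH0 : H 0 = 0) {M : ℝ}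
    (hM : ∀ x, |deriv H x| ≤ M) : ∃ φ : ℕ → (Fin n → ℝ) → ℝ,
    (∀ j, IsTestFunction Ω (fun x => H (φ j x))) ∧
    (∀ᵐ x ∂(volume.restrict Ω), Tendsto (fun j => H (φ j x)) atTop (𝓝 (H (v x)))) ∧
    TendstoW11 Ω (fun j x => H (φ j x)) (fun x => H (v x))
      (fun k x => deriv H (v x) * G k x) := by
  obtain ⟨φ, hφ, hae, ht, htG⟩ := h.exists_ae_approx
  have hH1 : ContDiff ℝ 1 H := hH.of_le (by exact_mod_cast le_top)
  have hd : Differentiable ℝ H := hH1.differentiable one_ne_zero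
  have hcd : Continuous (deriv H) := hH1.continuous_deriv le_rfl
  -- `H 0 = 0` keeps supports inside `Ω`. `H` is `M`-Lipschitz, which handles the functions; for
  -- gradients, `deriv H (φ j)` is bounded and converges almost everywhere.
  refine ⟨φ, fun j => (hφ j).comp hH hH0, ?_, ?_, fun k => ?_⟩
  · filter_upwards [hae] with x hx using (hH.continuous.tendsto _).comp hx
  · have hb : Tendsto (fun j => ENNReal.ofReal M * eLpNorm (fun x => v x - φ j x) 1
        (volume.restrict Ω)) atTop (𝓝 0) := by
      simpa using ENNReal.Tendsto.const_mul ht (Or.inr ENNReal.ofReal_ne_top)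
    refine tendsto_of_tendsto_of_tendsto_of_le_of_le tendsto_const_nhds hb
      (fun _ => zero_le) fun j => ?_
    refine eLpNorm_le_mul_eLpNorm_of_ae_le_mul (Eventually.of_forall fun x => ?_) 1
    exact Convex.norm_image_sub_le_of_norm_deriv_le (fun x _ => hd x) (fun x _ => hM x)
      convex_univ (Set.mem_univ _) (Set.mem_univ _)
  · refine (tendsto_eLpNorm_one_mul (α := fun x => deriv H (v x))
      (αj := fun j x => deriv H (φ j x))
      (fun j => (hcd.comp (hφ j).smooth.continuous).aestronglyMeasurable)
      (fun j x => hM _) ?_ (h.memLp_grad k) (fun j => ((hφ j).memLp_partialDeriv k).1)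
      (htG k)).congr fun j => ?_
    · filter_upwards [hae] with x hx using (hcd.tendsto _).comp hx
    · simp only [(hφ j).partialDeriv_comp hd]

lemma comp (h : IsW0Gradient Ω v G) {H : ℝ → ℝ}
    (hH : ContDiff ℝ ((⊤ : ℕ∞) : WithTop ℕ∞) H) (hH0 : H 0 = 0) {M : ℝ}
    (hM : ∀ x, |deriv H x| ≤ M) :
    IsW0Gradient Ω (fun x => H (v x)) (fun k x => deriv H (v x) * G k x) where
  memLp := by
    refine MemLp.of_le_mul (c := M) h.memLp (hH.continuous.comp_aestronglyMeasurable h.memLp.1)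
      (Eventually.of_forall fun x => ?_)
    have := Convex.norm_image_sub_le_of_norm_deriv_le (f := H) (C := M) (x := 0) (y := v x)
      (fun x _ => (hH.differentiable (by simp)) x) (fun x _ => hM x)
      convex_univ (Set.mem_univ _) (Set.mem_univ _)
    simpa [hH0] using this
  memLp_grad k := by
    have hcd : Continuous (deriv H) := (hH.of_le (by exact_mod_cast le_top)).continuous_deriv le_rfl
    refine MemLp.of_le_mul (c := M) (h.memLp_grad k)
      ((hcd.comp_aestronglyMeasurable h.memLp.1).mul (h.memLp_grad k).1)
      (Eventually.of_forall fun x => ?_)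
    rw [norm_mul]
    exact mul_le_mul_of_nonneg_right (hM _) (norm_nonneg _)
  approx := by
    obtain ⟨φ, hφ, -, ht⟩ := h.exists_comp_approx hH hH0 hM
    exact ⟨_, hφ, ht⟩

end IsW0Gradient

lemma MemW0.exists_isW0Gradient {r : Fin n → ℝ} {v : (Fin n → ℝ) → ℝ} (h : MemW0 Ω r v) :
    ∃ G, IsW0Gradient Ω v G ∧ ∀ k, MemLp (G k) (ENNReal.ofReal (r k)) (volume.restrict Ω) := by
  obtain ⟨hv, G, -, hG1, ⟨φ, hφ, ht⟩, hGr⟩ := h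
  exact ⟨G, ⟨hv, hG1, φ, hφ, ht⟩, hGr⟩

lemma IsW0Gradient.memW0 {r : Fin n → ℝ} {v : (Fin n → ℝ) → ℝ} {G : Fin n → (Fin n → ℝ) → ℝ}
    (h : IsW0Gradient Ω v G)
    (hr : ∀ k, MemLp (G k) (ENNReal.ofReal (r k)) (volume.restrict Ω)) : MemW0 Ω r v := by
  obtain ⟨φ, hφ, ht⟩ := h.approx
  exact ⟨h.memLp, G, h.isWeakGradient, h.memLp_grad, ⟨φ, hφ, ht⟩, hr⟩

/-- Weak gradients of integrable functions are additive. -/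
lemma IsWeakGradient.add {v v' : (Fin n → ℝ) → ℝ} {G G' : Fin n → (Fin n → ℝ) → ℝ}
    (h : IsWeakGradient Ω v G) (h' : IsWeakGradient Ω v' G')
    (hv : MemLp v 1 (volume.restrict Ω)) (hv' : MemLp v' 1 (volume.restrict Ω))
    (hG : ∀ k, MemLp (G k) 1 (volume.restrict Ω))
    (hG' : ∀ k, MemLp (G' k) 1 (volume.restrict Ω)) :
    IsWeakGradient Ω (fun x => v x + v' x) (fun k x => G k x + G' k x) where
  locallyIntegrable := h.locallyIntegrable.add h'.locallyIntegrable
  locallyIntegrable_grad k := (h.locallyIntegrable_grad k).add (h'.locallyIntegrable_grad k)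
  integral_eq k η hη := by
    obtain ⟨C, hC⟩ := hη.compact_support.exists_bound_of_continuous hη.smooth.continuous
    obtain ⟨C', hC'⟩ := (hη.hasCompactSupport_partialDeriv k).exists_bound_of_continuous
      (hη.continuous_partialDeriv k)
    have i1 : ∀ {g : (Fin n → ℝ) → ℝ}, MemLp g 1 (volume.restrict Ω) →
        Integrable (fun x => g x * partialDeriv k η x) (volume.restrict Ω) := fun hg =>
      (memLp_one_iff_integrable.1 hg).mul_bdd (hη.continuous_partialDeriv k).aestronglyMeasurable
        (Eventually.of_forall hC')
    have i2 : ∀ {g : (Fin n → ℝ) → ℝ}, MemLp g 1 (volume.restrict Ω) →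
        Integrable (fun x => g x * η x) (volume.restrict Ω) := fun hg =>
      (memLp_one_iff_integrable.1 hg).mul_bdd hη.smooth.continuous.aestronglyMeasurable
        (Eventually.of_forall hC)
    simp only [add_mul]
    rw [integral_add (i1 hv) (i1 hv'), integral_add (i2 (hG k)) (i2 (hG' k)),
      h.integral_eq k η hη, h'.integral_eq k η hη]
    ring

/-! ### The anisotropic Sobolev inequality -/

lemma ennreal_rpow_sum {ι : Type*} {S : Finset ι} {r : ι → ℝ} {a : ENNReal}
    (hr : ∀ i ∈ S, 0 ≤ r i) : a ^ (∑ i ∈ S, r i) = ∏ i ∈ S, a ^ r i := by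
  classical
  induction S using Finset.induction_on with
  | empty => simp
  | insert i S hi ih =>
    rw [Finset.sum_insert hi, Finset.prod_insert hi, ENNReal.rpow_add_of_nonneg _ _
      (hr i (Finset.mem_insert_self i S))
      (Finset.sum_nonneg fun j hj => hr j (Finset.mem_insert_of_mem hj)),
      ih fun j hj => hr j (Finset.mem_insert_of_mem hj)]

/-- A power of a test function is bounded by the integral of the corresponding partial derivative
along each line parallel to a coordinate axis. -/
lemma IsTestFunction.enorm_rpow_le_lintegral {φ : (Fin n → ℝ) → ℝ} (hφ : IsTestFunction Ω φ)
    {γ : ℝ} (hγ : 1 < γ) (k : Fin n) (x : Fin n → ℝ) :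
    ‖φ x‖ₑ ^ γ ≤ ∫⁻ y, ‖γ * |φ (Function.update x k y)| ^ (γ - 1) *
      partialDeriv k φ (Function.update x k y)‖ₑ := by
  have hup : ∀ y, HasDerivAt (fun y => φ (Function.update x k y))
      (partialDeriv k φ (Function.update x k y)) y := fun y =>
    (hφ.differentiable _).hasFDerivAt.comp_hasDerivAt y (hasDerivAt_update x k y)
  have hd : ∀ y, HasDerivAt (fun y => |φ (Function.update x k y)| ^ γ)
      (γ * |φ (Function.update x k y)| ^ (γ - 2) * φ (Function.update x k y) *
        partialDeriv k φ (Function.update x k y)) y := fun y =>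
    (hasDerivAt_abs_rpow _ hγ).comp y (hup y)
  -- `γ > 1` makes `|·|^γ` continuously differentiable at the zeros of `φ` too.
  have hc : ContDiff ℝ 1 (fun y => |φ (Function.update x k y)| ^ γ) := by
    have h1 : ContDiff ℝ 1 (fun y => φ (Function.update x k y)) :=
      hφ.contDiff_one.comp (contDiff_update 1 x k)
    exact (contDiff_norm_rpow (E := ℝ) hγ).comp h1
  have hs : HasCompactSupport (fun y => |φ (Function.update x k y)| ^ γ) := by
    have h1 : HasCompactSupport (φ ∘ Function.update x k) :=
      hφ.compact_support.comp_isClosedEmbedding (isClosedEmbedding_update x k)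
    exact h1.comp_left (g := fun y : ℝ => |y| ^ γ) (by simp [Real.zero_rpow (by linarith : γ ≠ 0)])
  have key := hs.enorm_le_lintegral_Ici_deriv hc (x k)
  calc ‖φ x‖ₑ ^ γ = ‖|φ (Function.update x k (x k))| ^ γ‖ₑ := by
        rw [Function.update_eq_self, Real.enorm_rpow_of_nonneg (abs_nonneg _) (by linarith)]
        simp
    _ ≤ _ := key
    _ ≤ ∫⁻ y, ‖deriv (fun y => |φ (Function.update x k y)| ^ γ) y‖ₑ := setLIntegral_le_lintegral _ _
    _ = _ := by
        refine lintegral_congr fun y => ?_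
        rw [(hd y).deriv]
        simp only [Real.enorm_eq_ofReal_abs]
        congr 1
        rw [abs_mul, abs_mul _ (partialDeriv _ _ _)]
        congr 1
        simp only [abs_mul, abs_abs, Real.abs_rpow_of_nonneg (abs_nonneg _)]
        rw [mul_assoc]
        congr 1
        -- `γ - 2` may be negative, so zeros are treated apart; there both sides vanish because `γ -
        -- 1 > 0`.
        rcases eq_or_ne (φ (Function.update x k y)) 0 with h0 | h0
        · simp [h0, Real.zero_rpow (by linarith : γ - 1 ≠ 0)]
        · rw [show γ - 1 = γ - 2 + 1 by ring, Real.rpow_add_one (abs_ne_zero.2 h0)]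

/-- The anisotropic Gagliardo–Nirenberg inequality for test functions, with free weights `w_k`. -/
lemma IsTestFunction.lintegral_rpow_le (hn : 2 ≤ n) {φ : (Fin n → ℝ) → ℝ}
    (hφ : IsTestFunction Ω φ) {γ : Fin n → ℝ} (hγ : ∀ k, 1 < γ k) {s : ℝ}
    (hs : ∑ k, γ k = (n - 1) * s) {w : Fin n → ENNReal} (hw0 : ∀ k, w k ≠ 0)
    (hw : ∀ k, w k ≠ ⊤) :
    ∫⁻ x in Ω, ‖φ x‖ₑ ^ s ≤ (∏ k, w k ^ ((1 : ℝ) / (n - 1))) *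
      (∑ k, (w k)⁻¹ * ∫⁻ x in Ω, ‖γ k * |φ x| ^ (γ k - 1) * partialDeriv k φ x‖ₑ) ^
        ((n : ℝ) / (n - 1)) := by
  have hn1 : (0 : ℝ) < n - 1 := by
    have : (2 : ℝ) ≤ n := by exact_mod_cast hn
    linarith
  have hr : 0 ≤ (1 : ℝ) / (n - 1) := by positivity
  -- The grid-lines inequality accepts one function for all directions, so the `n` derivatives are
  -- merged into a weighted sum. A suitable choice of weights later recovers the product form.
  set f : (Fin n → ℝ) → ENNReal := fun x =>
    ∑ k, (w k)⁻¹ * ‖γ k * |φ x| ^ (γ k - 1) * partialDeriv k φ x‖ₑ with hf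
  have hmeas : ∀ k, Measurable fun x => ‖γ k * |φ x| ^ (γ k - 1) * partialDeriv k φ x‖ₑ := by
    intro k
    have := (hφ.continuous_partialDeriv k).measurable
    have := hφ.smooth.continuous.measurable
    fun_prop
  have hfm : Measurable f := Finset.measurable_sum _ fun k _ => (hmeas k).const_mul _
  have hgrid := lintegral_prod_lintegral_pow_le (fun _ : Fin n => (volume : Measure ℝ))
    (p := (n : ℝ) / (n - 1)) (by
      rw [Real.holderConjugate_iff]
      refine ⟨by simp only [Fintype.card_fin]; linarith, ?_⟩
      simp only [Fintype.card_fin]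
      field_simp
      ring) hfm
  have hline : ∀ x k, ‖φ x‖ₑ ^ γ k ≤ w k * ∫⁻ y, f (Function.update x k y) := by
    intro x k
    refine (hφ.enorm_rpow_le_lintegral (hγ k) k x).trans ?_
    rw [← lintegral_const_mul' _ _ (hw k)]
    refine lintegral_mono fun y => ?_
    calc _ = w k * ((w k)⁻¹ * ‖γ k * |φ (Function.update x k y)| ^ (γ k - 1) *
          partialDeriv k φ (Function.update x k y)‖ₑ) := by
          rw [← mul_assoc, ENNReal.mul_inv_cancel (hw0 k) (hw k), one_mul]
      _ ≤ _ := by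
          gcongr
          exact Finset.single_le_sum (f := fun i => (w i)⁻¹ *
            ‖γ i * |φ (Function.update x k y)| ^ (γ i - 1) *
              partialDeriv i φ (Function.update x k y)‖ₑ)
            (fun _ _ => zero_le) (Finset.mem_univ k)
  have hpt : ∀ x, ‖φ x‖ₑ ^ s ≤ (∏ k, w k ^ ((1 : ℝ) / (n - 1))) *
      ∏ k, (∫⁻ y, f (Function.update x k y)) ^ ((1 : ℝ) / (n - 1)) := by
    intro x
    rw [← Finset.prod_mul_distrib]
    have : ‖φ x‖ₑ ^ s = ∏ k, (‖φ x‖ₑ ^ γ k) ^ ((1 : ℝ) / (n - 1)) := by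
      simp only [← ENNReal.rpow_mul]
      rw [← ennreal_rpow_sum fun k _ => mul_nonneg (by linarith [hγ k]) hr,
        ← Finset.sum_mul, hs]
      congr 1
      field_simp
    rw [this]
    refine Finset.prod_le_prod' fun k _ => ?_
    rw [← ENNReal.mul_rpow_of_nonneg _ _ hr]
    exact ENNReal.rpow_le_rpow (hline x k) hr
  have hΩ : ∫⁻ x, f x = ∑ k, (w k)⁻¹ *
      ∫⁻ x in Ω, ‖γ k * |φ x| ^ (γ k - 1) * partialDeriv k φ x‖ₑ := by
    rw [lintegral_finsetSum _ fun k _ => (hmeas k).const_mul _]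
    refine Finset.sum_congr rfl fun k _ => ?_
    rw [lintegral_const_mul _ (hmeas k), setLIntegral_eq_of_support_subset]
    intro x hx
    by_contra h
    simp [hφ.partialDeriv_eq_zero k h] at hx
  calc ∫⁻ x in Ω, ‖φ x‖ₑ ^ s ≤ ∫⁻ x, ‖φ x‖ₑ ^ s := setLIntegral_le_lintegral _ _
    _ ≤ ∫⁻ x, (∏ k, w k ^ ((1 : ℝ) / (n - 1))) *
        ∏ k, (∫⁻ y, f (Function.update x k y)) ^ ((1 : ℝ) / (n - 1)) := lintegral_mono hpt
    _ = (∏ k, w k ^ ((1 : ℝ) / (n - 1))) *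
        ∫⁻ x, ∏ k, (∫⁻ y, f (Function.update x k y)) ^ ((1 : ℝ) / (n - 1)) := by
        refine lintegral_const_mul' _ _ (ENNReal.prod_ne_top fun k _ => ?_)
        exact ENNReal.rpow_ne_top_of_nonneg hr (hw k)
    _ ≤ _ := by
        gcongr
        rw [← hΩ]
        simp only [Fintype.card_fin] at hgrid
        exact hgrid

/-- The anisotropic Gagliardo–Nirenberg inequality for bounded limits of test functions. -/
lemma lintegral_rpow_le_of_tendstoW11 (hn : 2 ≤ n) {φ : ℕ → (Fin n → ℝ) → ℝ}
    (hφ : ∀ j, IsTestFunction Ω (φ j)) {B : ℝ} (hB : ∀ j x, |φ j x| ≤ B)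
    {g : (Fin n → ℝ) → ℝ} {G : Fin n → (Fin n → ℝ) → ℝ}
    (hG : ∀ k, MemLp (G k) 1 (volume.restrict Ω))
    (hae : ∀ᵐ x ∂(volume.restrict Ω), Tendsto (fun j => φ j x) atTop (𝓝 (g x)))
    (ht : TendstoW11 Ω φ g G) {γ : Fin n → ℝ} (hγ : ∀ k, 1 < γ k) {s : ℝ}
    (hs : ∑ k, γ k = (n - 1) * s) {w : Fin n → ENNReal} (hw0 : ∀ k, w k ≠ 0)
    (hw : ∀ k, w k ≠ ⊤) :
    ∫⁻ x in Ω, ‖g x‖ₑ ^ s ≤ (∏ k, w k ^ ((1 : ℝ) / (n - 1))) *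
      (∑ k, (w k)⁻¹ * ∫⁻ x in Ω, ‖γ k * |g x| ^ (γ k - 1) * G k x‖ₑ) ^ ((n : ℝ) / (n - 1)) := by
  have hn1 : (0 : ℝ) < n - 1 := by
    have : (2 : ℝ) ≤ n := by exact_mod_cast hn
    linarith
  set ε : Fin n → ℕ → ENNReal := fun k j => eLpNorm (fun x => γ k * |g x| ^ (γ k - 1) * G k x -
    γ k * |φ j x| ^ (γ k - 1) * partialDeriv k (φ j) x) 1 (volume.restrict Ω) with hε
  have hm : ∀ j k, AEStronglyMeasurable (fun x => γ k * |φ j x| ^ (γ k - 1))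
      (volume.restrict Ω) := fun j k => by
    have := (hφ j).smooth.continuous.measurable
    exact Measurable.aestronglyMeasurable (by fun_prop)
  have hlim : ∀ k, ∀ᵐ x ∂(volume.restrict Ω), Tendsto (fun j => γ k * |φ j x| ^ (γ k - 1)) atTop
      (𝓝 (γ k * |g x| ^ (γ k - 1))) := fun k => by
    filter_upwards [hae] with x hx
    exact (hx.abs.rpow_const (Or.inr (by linarith [hγ k]))).const_mul _
  -- The uniform bound `B` enters here: it makes the factors `γ_k |φ_j|^{γ_k - 1}` bounded uniformly
  -- in `j`.
  have hεt : ∀ k, Tendsto (ε k) atTop (𝓝 0) := fun k => by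
    refine tendsto_eLpNorm_one_mul (M := γ k * B ^ (γ k - 1)) (fun j => hm j k) (fun j x => ?_)
      (hlim k) (hG k) (fun j => ((hφ j).memLp_partialDeriv k).1) (ht.2 k)
    have := hγ k
    rw [abs_of_nonneg (by positivity)]
    have hBx := hB j x
    have : 0 ≤ γ k - 1 := by linarith
    gcongr
  have hle : ∀ j, ∫⁻ x in Ω, ‖φ j x‖ₑ ^ s ≤ (∏ k, w k ^ ((1 : ℝ) / (n - 1))) *
      (∑ k, (w k)⁻¹ * ((∫⁻ x in Ω, ‖γ k * |g x| ^ (γ k - 1) * G k x‖ₑ) + ε k j)) ^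
        ((n : ℝ) / (n - 1)) := fun j => by
    refine ((hφ j).lintegral_rpow_le hn hγ hs hw0 hw).trans ?_
    gcongr with k
    have hgm : AEStronglyMeasurable (fun x => γ k * |g x| ^ (γ k - 1) * G k x)
        (volume.restrict Ω) := (aestronglyMeasurable_of_tendsto_ae _ (hm · k) (hlim k)).mul (hG k).1
    simp only [hε, eLpNorm_one_eq_lintegral_enorm]
    rw [← lintegral_add_left' hgm.enorm]
    refine lintegral_mono fun x => ?_
    refine le_trans (le_of_eq ?_) (enorm_sub_le (E := ℝ))
    congr 1
    ring
  have hR : Tendsto (fun j => (∏ k, w k ^ ((1 : ℝ) / (n - 1))) *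
      (∑ k, (w k)⁻¹ * ((∫⁻ x in Ω, ‖γ k * |g x| ^ (γ k - 1) * G k x‖ₑ) + ε k j)) ^
        ((n : ℝ) / (n - 1))) atTop (𝓝 ((∏ k, w k ^ ((1 : ℝ) / (n - 1))) *
      (∑ k, (w k)⁻¹ * ∫⁻ x in Ω, ‖γ k * |g x| ^ (γ k - 1) * G k x‖ₑ) ^ ((n : ℝ) / (n - 1)))) := by
    refine ENNReal.Tendsto.const_mul ?_ (Or.inr (ENNReal.prod_ne_top fun k _ =>
      ENNReal.rpow_ne_top_of_nonneg (by positivity) (hw k)))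
    refine (ENNReal.continuous_rpow_const.tendsto _).comp ?_
    refine tendsto_finsetSum _ fun k _ => ENNReal.Tendsto.const_mul ?_
      (Or.inr (ENNReal.inv_ne_top.2 (hw0 k)))
    simpa using tendsto_const_nhds.add (hεt k)
  -- Fatou on the left; on the right the errors `ε k j` tend to zero.
  calc ∫⁻ x in Ω, ‖g x‖ₑ ^ s = ∫⁻ x in Ω, liminf (fun j => ‖φ j x‖ₑ ^ s) atTop := by
        refine lintegral_congr_ae ?_
        filter_upwards [hae] with x hx
        exact (((ENNReal.continuous_rpow_const.tendsto _).comp hx.enorm).liminf_eq).symm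
    _ ≤ liminf (fun j => ∫⁻ x in Ω, ‖φ j x‖ₑ ^ s) atTop := by
        refine lintegral_liminf_le' fun j => ?_
        exact ((hφ j).memLp.1.enorm).pow_const _
    _ ≤ liminf (fun j => (∏ k, w k ^ ((1 : ℝ) / (n - 1))) *
      (∑ k, (w k)⁻¹ * ((∫⁻ x in Ω, ‖γ k * |g x| ^ (γ k - 1) * G k x‖ₑ) + ε k j)) ^
        ((n : ℝ) / (n - 1))) atTop := liminf_le_liminf (Eventually.of_forall hle)
    _ = _ := hR.liminf_eq

/-- The exponent `γ` is chosen so that `(γ - 1) p' = s`. Hölder then produces `∫ |g|^s` again, the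
quantity being estimated, which can be absorbed. -/
lemma lintegral_enorm_mul_le_holder {X : Type*} [MeasurableSpace X] {μ : Measure X} {g G : X → ℝ}
    (hg : AEStronglyMeasurable g μ) (hG : AEStronglyMeasurable G μ) {p s γ : ℝ} (hp : 1 < p)
    (hs : 0 < s) (hγ : γ = 1 + s * (1 - 1 / p)) :
    ∫⁻ x, ‖γ * |g x| ^ (γ - 1) * G x‖ₑ ∂μ ≤ ENNReal.ofReal γ *
      ((∫⁻ x, ‖g x‖ₑ ^ s ∂μ) ^ (1 - 1 / p) * (∫⁻ x, ‖G x‖ₑ ^ p ∂μ) ^ (1 / p)) := by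
  have hp0 : 0 < 1 - 1 / p := by
    rw [sub_pos, div_lt_one (by linarith)]
    exact hp
  have hγ0 : 0 < γ - 1 := by rw [hγ]; simpa using mul_pos hs hp0
  have hpq : (1 - 1 / p)⁻¹.HolderConjugate p := by
    rw [Real.holderConjugate_comm, Real.holderConjugate_iff]
    refine ⟨hp, ?_⟩
    simp
  have h := ENNReal.lintegral_mul_le_Lp_mul_Lq μ hpq (f := fun x => ‖g x‖ₑ ^ (γ - 1))
    (g := fun x => ‖G x‖ₑ) (hg.enorm.pow_const _) hG.enorm
  calc _ = ∫⁻ x, ENNReal.ofReal γ * ((fun x => ‖g x‖ₑ ^ (γ - 1)) * fun x => ‖G x‖ₑ) x ∂μ := by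
        refine lintegral_congr fun x => ?_
        rw [enorm_mul, enorm_mul, Real.enorm_rpow_of_nonneg (abs_nonneg _) hγ0.le,
          Real.enorm_of_nonneg (by linarith), Pi.mul_apply, mul_assoc]
        simp
    _ = ENNReal.ofReal γ * _ := lintegral_const_mul' _ _ ENNReal.ofReal_ne_top
    _ ≤ _ := by
        gcongr
        refine h.trans (le_of_eq ?_)
        congr 1
        · rw [one_div (1 - 1 / p)⁻¹, inv_inv]
          congr 1
          refine lintegral_congr fun x => ?_
          rw [← ENNReal.rpow_mul]
          congr 1
          rw [hγ, add_sub_cancel_left, mul_assoc, mul_inv_cancel₀ hp0.ne', mul_one]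

/-- The **anisotropic Sobolev inequality** (Troisi) for bounded limits of test functions. -/
lemma exists_anisotropic_sobolev (hn : 2 ≤ n) {p : Fin n → ℝ} (hp : ∀ k, 1 < p k)
    (hP : 1 < ∑ k, 1 / p k) {s : ℝ} (hs : s = n / (∑ k, 1 / p k - 1)) (hΩ : volume Ω ≠ ⊤) :
    ∃ C : ℝ, 0 < C ∧ ∀ (φ : ℕ → (Fin n → ℝ) → ℝ) (g : (Fin n → ℝ) → ℝ)
      (G : Fin n → (Fin n → ℝ) → ℝ) (B m : ℝ), 0 < m → (∀ j, IsTestFunction Ω (φ j)) →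
      (∀ j x, |φ j x| ≤ B) → (∀ x, |g x| ≤ B) → (∀ k, MemLp (G k) 1 (volume.restrict Ω)) →
      (∀ᵐ x ∂(volume.restrict Ω), Tendsto (fun j => φ j x) atTop (𝓝 (g x))) →
      TendstoW11 Ω φ g G →
      (∀ k, ∫⁻ x in Ω, ‖G k x‖ₑ ^ p k ≤ ENNReal.ofReal m) →
      ∫⁻ x in Ω, ‖g x‖ₑ ^ s ≤
        ENNReal.ofReal (C * m ^ ((∑ k, 1 / p k) / (∑ k, 1 / p k - 1))) := by
  set P := ∑ k, 1 / p k with hPdef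
  have hn2 : (2 : ℝ) ≤ n := by exact_mod_cast hn
  have hn1 : (0 : ℝ) < n - 1 := by linarith
  have hs0 : 0 < s := by
    rw [hs]
    exact div_pos (by linarith) (by linarith)
  have hp1 : ∀ k, 0 < 1 - 1 / p k := fun k => by
    have := hp k
    rw [sub_pos, div_lt_one (by linarith)]
    exact this
  set γ : Fin n → ℝ := fun k => 1 + s * (1 - 1 / p k) with hγdef
  have hγ : ∀ k, 1 < γ k := fun k => by
    have := mul_pos hs0 (hp1 k)
    simp only [hγdef]
    linarith
  -- This identity is equivalent to `s (P - 1) = n` and so determines the Sobolev exponent.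
  have hγs : ∑ k, γ k = (n - 1) * s := by
    simp only [hγdef, Finset.sum_add_distrib, ← Finset.mul_sum, Finset.sum_sub_distrib, ← hPdef]
    simp only [Finset.sum_const, Finset.card_univ, Fintype.card_fin, nsmul_eq_mul, mul_one]
    rw [hs]
    field_simp [(by linarith : P - 1 ≠ 0)]
    ring
  set K : ℝ := (∏ k, γ k ^ ((1 : ℝ) / (n - 1))) * (n : ℝ) ^ ((n : ℝ) / (n - 1)) with hK
  have hγ0 : ∀ k, 0 < γ k := fun k => by linarith [hγ k]
  have hK0 : 0 < K := mul_pos (Finset.prod_pos fun k _ => Real.rpow_pos_of_pos (hγ0 k) _)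
    (Real.rpow_pos_of_pos (by linarith) _)
  refine ⟨K ^ ((n - 1) / (P - 1)), Real.rpow_pos_of_pos hK0 _, ?_⟩
  intro φ g G B m hm hφ hB hgB hG hae ht hGm
  have hgm : AEStronglyMeasurable g (volume.restrict Ω) :=
    aestronglyMeasurable_of_tendsto_ae _ (fun j => (hφ j).memLp.1) hae
  set X := ∫⁻ x in Ω, ‖g x‖ₑ ^ s with hX
  -- Absorption divides by a power of `X`, so `X` must be finite. This uses that `g` is bounded and
  -- `Ω` has finite measure.
  have hXt : X ≠ ⊤ := by
    have : X ≤ ∫⁻ x in Ω, ENNReal.ofReal B ^ s := by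
      refine lintegral_mono fun x => ENNReal.rpow_le_rpow ?_ hs0.le
      rw [Real.enorm_eq_ofReal_abs]
      exact ENNReal.ofReal_le_ofReal (hgB x)
    refine ne_top_of_le_ne_top ?_ this
    rw [setLIntegral_const]
    exact ENNReal.mul_ne_top (ENNReal.rpow_ne_top_of_nonneg hs0.le ENNReal.ofReal_ne_top) hΩ
  rcases eq_or_ne X 0 with hX0 | hX0
  · rw [hX0]; exact zero_le
  obtain ⟨x, hx, hXx⟩ : ∃ x : ℝ, 0 < x ∧ X = ENNReal.ofReal x :=
    ⟨X.toReal, ENNReal.toReal_pos hX0 hXt, (ENNReal.ofReal_toReal hXt).symm⟩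
  -- The weight is the Hölder bound for the `k`-th integral, so each weighted term is at most `1`
  -- and their sum at most `n`.
  set w : Fin n → ℝ := fun k => γ k * (x ^ (1 - 1 / p k) * m ^ (1 / p k)) with hw
  have hw0 : ∀ k, 0 < w k := fun k => mul_pos (hγ0 k)
    (mul_pos (Real.rpow_pos_of_pos hx _) (Real.rpow_pos_of_pos hm _))
  have hmain := lintegral_rpow_le_of_tendstoW11 hn hφ hB hG hae ht hγ hγs
    (w := fun k => ENNReal.ofReal (w k)) (fun k => by simpa using hw0 k)
    (fun k => ENNReal.ofReal_ne_top)
  have hI : ∀ k, ∫⁻ x in Ω, ‖γ k * |g x| ^ (γ k - 1) * G k x‖ₑ ≤ ENNReal.ofReal (w k) := by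
    intro k
    refine (lintegral_enorm_mul_le_holder hgm (hG k).1 (hp k) hs0 rfl).trans ?_
    have hpk : 0 ≤ 1 / p k := by have := hp k; positivity
    rw [hw, ENNReal.ofReal_mul (hγ0 k).le, ENNReal.ofReal_mul (by positivity),
      ← ENNReal.ofReal_rpow_of_pos hx, ← ENNReal.ofReal_rpow_of_pos hm, ← hXx]
    gcongr
    exact hGm k
  have hsum : ∑ k, (ENNReal.ofReal (w k))⁻¹ * ∫⁻ x in Ω, ‖γ k * |g x| ^ (γ k - 1) * G k x‖ₑ ≤
      ENNReal.ofReal n := by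
    calc _ ≤ ∑ k : Fin n, (1 : ENNReal) := by
          refine Finset.sum_le_sum fun k _ => ?_
          calc _ ≤ (ENNReal.ofReal (w k))⁻¹ * ENNReal.ofReal (w k) := by
                gcongr
                exact hI k
            _ = 1 := ENNReal.inv_mul_cancel (by simpa using hw0 k) ENNReal.ofReal_ne_top
      _ = _ := by simp
  have hreal : x ≤ K * (x ^ ((n - P) / (n - 1)) * m ^ (P / (n - 1))) := by
    have h1 : ENNReal.ofReal x ≤ ENNReal.ofReal ((∏ k, w k ^ ((1 : ℝ) / (n - 1))) *
        (n : ℝ) ^ ((n : ℝ) / (n - 1))) := by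
      rw [← hXx, ENNReal.ofReal_mul (Finset.prod_nonneg fun k _ =>
        Real.rpow_nonneg (hw0 k).le _), ENNReal.ofReal_prod_of_nonneg fun k _ =>
        Real.rpow_nonneg (hw0 k).le _, ← ENNReal.ofReal_rpow_of_pos (by linarith : (0 : ℝ) < n)]
      refine hmain.trans ?_
      simp only [ENNReal.ofReal_rpow_of_pos (hw0 _)]
      gcongr
    have h2 := (ENNReal.ofReal_le_ofReal_iff (by
      have := Finset.prod_nonneg fun k (_ : k ∈ Finset.univ) =>
        Real.rpow_nonneg (hw0 k).le ((1 : ℝ) / (n - 1))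
      positivity)).1 h1
    refine h2.trans (le_of_eq ?_)
    have h3 : ∏ k, w k ^ ((1 : ℝ) / (n - 1)) = (∏ k, γ k ^ ((1 : ℝ) / (n - 1))) *
        (x ^ ((n - P) / (n - 1)) * m ^ (P / (n - 1))) := by
      have : ∀ k, w k ^ ((1 : ℝ) / (n - 1)) = γ k ^ ((1 : ℝ) / (n - 1)) *
          (x ^ ((1 - 1 / p k) / (n - 1)) * m ^ ((1 / p k) / (n - 1))) := fun k => by
        rw [hw, Real.mul_rpow (hγ0 k).le (by positivity), Real.mul_rpow (by positivity)
          (by positivity), ← Real.rpow_mul hx.le, ← Real.rpow_mul hm.le, mul_one_div, mul_one_div]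
      simp only [this, Finset.prod_mul_distrib]
      rw [← Real.rpow_sum_of_pos hx, ← Real.rpow_sum_of_pos hm, ← Finset.sum_div,
        ← Finset.sum_div, Finset.sum_sub_distrib, ← hPdef]
      simp
    rw [h3, hK]
    ring
  rw [hXx]
  refine ENNReal.ofReal_le_ofReal ?_
  have hP1 : 0 < P - 1 := by linarith
  -- Absorption: a factor `x ^ ((n - P) / (n - 1))` is cancelled, leaving a positive power of `x`
  -- since `P > 1`.
  have h4 : x ^ ((P - 1) / (n - 1)) ≤ K * m ^ (P / (n - 1)) := by
    have hxa : 0 < x ^ ((n - P) / (n - 1)) := Real.rpow_pos_of_pos hx _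
    refine le_of_mul_le_mul_right ?_ hxa
    rw [← Real.rpow_add hx]
    calc _ = x := by
          rw [← add_div, show P - 1 + (n - P) = n - 1 by ring, div_self hn1.ne', Real.rpow_one]
      _ ≤ _ := hreal
      _ = _ := by ring
  have h5 := Real.rpow_le_rpow (by positivity) h4 (by positivity : 0 ≤ (n - 1) / (P - 1))
  rw [← Real.rpow_mul hx.le, Real.mul_rpow hK0.le (by positivity), ← Real.rpow_mul hm.le] at h5
  convert h5 using 2
  · rw [div_mul_div_comm, mul_comm, div_self (by positivity), Real.rpow_one]
  · field_simp

/-! ### Smooth cutoffs -/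

/-- A smooth cutoff: zero on `[-1, 1]`, equal to `±1` outside `(-2, 2)`. -/
noncomputable def cutoff (s : ℝ) : ℝ :=
  Real.smoothTransition (s - 1) - Real.smoothTransition (-s - 1)

lemma contDiff_cutoff : ContDiff ℝ ((⊤ : ℕ∞) : WithTop ℕ∞) cutoff :=
  (Real.smoothTransition.contDiff.comp (contDiff_id.sub contDiff_const)).sub
    (Real.smoothTransition.contDiff.comp (contDiff_neg.sub contDiff_const))

lemma abs_cutoff_le_one (s : ℝ) : |cutoff s| ≤ 1 := by
  have h1 := Real.smoothTransition.nonneg (s - 1)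
  have h2 := Real.smoothTransition.nonneg (-s - 1)
  have h3 := Real.smoothTransition.le_one (s - 1)
  have h4 := Real.smoothTransition.le_one (-s - 1)
  rw [cutoff, abs_le]
  constructor <;> linarith

lemma cutoff_eq_zero {s : ℝ} (hs : |s| ≤ 1) : cutoff s = 0 := by
  rw [abs_le] at hs
  rw [cutoff, Real.smoothTransition.zero_of_nonpos (by linarith),
    Real.smoothTransition.zero_of_nonpos (by linarith), sub_zero]

lemma monotone_cutoff : Monotone cutoff := fun a b hab =>
  sub_le_sub (Real.smoothTransition.monotone (by linarith))
    (Real.smoothTransition.monotone (by linarith))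

lemma abs_cutoff_eq_one {s : ℝ} (hs : 2 ≤ |s|) : |cutoff s| = 1 := by
  rcases le_abs.1 hs with h | h
  · rw [cutoff, Real.smoothTransition.one_of_one_le (by linarith),
      Real.smoothTransition.zero_of_nonpos (by linarith)]
    simp
  · rw [cutoff, Real.smoothTransition.one_of_one_le (x := -s - 1) (by linarith),
      Real.smoothTransition.zero_of_nonpos (by linarith)]
    simp

lemma cutoff_le_self {s : ℝ} (hs : 0 ≤ s) : cutoff s ≤ s := by
  rcases le_total s 1 with h | h
  · rwa [cutoff_eq_zero (by rwa [abs_of_nonneg hs])]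
  · exact (le_abs_self _).trans ((abs_cutoff_le_one s).trans h)

/-- These points are global minima or maxima of the transition, so Fermat's theorem also covers the
endpoints `0` and `1`. -/
lemma deriv_smoothTransition_eq_zero {x : ℝ} (hx : x ≤ 0 ∨ 1 ≤ x) :
    deriv Real.smoothTransition x = 0 := by
  rcases hx with h | h
  · refine IsLocalMin.deriv_eq_zero (Eventually.of_forall fun y => ?_)
    simpa [Real.smoothTransition.zero_of_nonpos h] using Real.smoothTransition.nonneg y
  · refine IsLocalMax.deriv_eq_zero (Eventually.of_forall fun y => ?_)
    simpa [Real.smoothTransition.one_of_one_le h] using Real.smoothTransition.le_one y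

lemma deriv_cutoff (s : ℝ) : deriv cutoff s =
    deriv Real.smoothTransition (s - 1) + deriv Real.smoothTransition (-s - 1) := by
  have hd : Differentiable ℝ Real.smoothTransition :=
    (Real.smoothTransition.contDiff (n := 1)).differentiable one_ne_zero
  have h1 : HasDerivAt (fun s => Real.smoothTransition (s - 1))
      (deriv Real.smoothTransition (s - 1)) s := by
    have := (hd (s - 1)).hasDerivAt.comp s ((hasDerivAt_id s).sub_const 1)
    rwa [mul_one] at this
  have h2 : HasDerivAt (fun s => Real.smoothTransition (-s - 1))
      (-deriv Real.smoothTransition (-s - 1)) s := by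
    have := (hd (-s - 1)).hasDerivAt.comp s ((hasDerivAt_neg s).sub_const 1)
    rwa [mul_neg_one] at this
  have := (h1.sub h2).deriv
  rw [sub_neg_eq_add] at this
  exact this

lemma deriv_cutoff_eq_zero {s : ℝ} (hs : |s| ≤ 1) : deriv cutoff s = 0 := by
  rw [abs_le] at hs
  rw [deriv_cutoff, deriv_smoothTransition_eq_zero (Or.inl (by linarith)),
    deriv_smoothTransition_eq_zero (Or.inl (by linarith)), add_zero]

lemma exists_deriv_cutoff_le : ∃ M : ℝ, 1 ≤ M ∧ ∀ s, deriv cutoff s ≤ M := by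
  have hc : Continuous (deriv cutoff) :=
    (contDiff_cutoff.of_le (by exact_mod_cast le_top)).continuous_deriv le_rfl
  have hs : HasCompactSupport (deriv cutoff) := by
    refine HasCompactSupport.intro (isCompact_Icc (a := (-2 : ℝ)) (b := 2)) fun s hs => ?_
    rw [deriv_cutoff]
    rw [Set.mem_Icc, not_and_or, not_le, not_le] at hs
    rcases hs with h | h
    · rw [deriv_smoothTransition_eq_zero (Or.inl (by linarith)),
        deriv_smoothTransition_eq_zero (Or.inr (by linarith)), add_zero]
    · rw [deriv_smoothTransition_eq_zero (Or.inr (by linarith)),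
        deriv_smoothTransition_eq_zero (Or.inl (by linarith)), add_zero]
  obtain ⟨C, hC⟩ := hs.exists_bound_of_continuous hc
  -- A bound at least `1` has powers that increase with the exponent, as used in the gradient
  -- estimate.
  exact ⟨max 1 C, le_max_left _ _, fun s => (le_abs_self _).trans ((hC s).trans (le_max_right _ _))⟩

/-- The cutoffs at level `L`, with derivatives bounded uniformly in `L`. -/
lemma exists_cutoff : ∃ M : ℝ, 1 ≤ M ∧ ∀ L : ℝ, 0 < L → ∃ H : ℝ → ℝ,
    ContDiff ℝ ((⊤ : ℕ∞) : WithTop ℕ∞) H ∧ (∀ s, |H s| ≤ L) ∧ (∀ s, 0 ≤ deriv H s) ∧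
    (∀ s, deriv H s ≤ M) ∧ (∀ s, |s| ≤ L → deriv H s = 0) ∧ (∀ s, 2 * L ≤ |s| → |H s| = L) ∧
    H 0 = 0 ∧ (∀ s, 0 ≤ s → H s ≤ s) ∧ (∀ s, s ≤ 0 → H s ≤ 0) := by
  obtain ⟨M, hM1, hM⟩ := exists_deriv_cutoff_le
  refine ⟨M, hM1, fun L hL => ⟨fun s => L * cutoff (s / L), ?_⟩⟩
  -- The factors `L` and `1 / L` cancel, so the derivative bound is independent of `L`.
  have hd : ∀ s, deriv (fun s => L * cutoff (s / L)) s = deriv cutoff (s / L) := fun s => by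
    have h1 : HasDerivAt cutoff (deriv cutoff (s / L)) (s / L) :=
      (contDiff_cutoff.differentiable (by simp) _).hasDerivAt
    have h2 : HasDerivAt (fun s => L * cutoff (s / L)) (L * (deriv cutoff (s / L) * (1 / L))) s :=
      (HasDerivAt.comp (h := fun s => s / L) s h1 ((hasDerivAt_id s).div_const L)).const_mul L
    rw [h2.deriv]
    field_simp
  have habs : ∀ s, |s / L| = |s| / L := fun s => by rw [abs_div, abs_of_pos hL]
  have hHabs : ∀ s, |L * cutoff (s / L)| = L * |cutoff (s / L)| := fun s => by
    rw [abs_mul, abs_of_pos hL]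
  have h0 : cutoff 0 = 0 := cutoff_eq_zero (by simp)
  refine ⟨contDiff_const.mul (contDiff_cutoff.comp (contDiff_id.div_const L)), fun s => ?_,
    fun s => ?_, fun s => ?_, fun s hs => ?_, fun s hs => ?_, by simp [h0], fun s hs => ?_,
    fun s hs => ?_⟩
  · rw [hHabs]
    exact mul_le_of_le_one_right hL.le (abs_cutoff_le_one _)
  · rw [hd]; exact monotone_cutoff.deriv_nonneg
  · rw [hd]; exact hM _
  · rw [hd]
    exact deriv_cutoff_eq_zero (by rwa [habs, div_le_one hL])
  · rw [hHabs, abs_cutoff_eq_one (by rwa [habs, le_div_iff₀ hL]), mul_one]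
  · calc L * cutoff (s / L) ≤ L * (s / L) := by
          gcongr
          exact cutoff_le_self (by positivity)
      _ = s := by field_simp
  · refine mul_nonpos_of_nonneg_of_nonpos hL.le ?_
    rw [← h0]
    exact monotone_cutoff (div_nonpos_of_nonpos_of_nonneg hs hL.le)

/-! ### Young, Hölder and the energy estimate -/

/-- Young's inequality with a small parameter. -/
lemma exists_young {p : ℝ} (hp : 1 < p) {ε : ℝ} (hε : 0 < ε) : ∃ C : ℝ, 0 ≤ C ∧ ∀ x y : ℝ,
    x * y ≤ ε * |y| ^ p + C * |x| ^ (p / (p - 1)) := by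
  have hp0 : 0 < p := by linarith
  have hpq : p.HolderConjugate (p / (p - 1)) := Real.HolderConjugate.conjExponent hp
  set δ : ℝ := ε ^ (1 / p) with hδ
  have hδ0 : 0 < δ := Real.rpow_pos_of_pos hε _
  have hδp : δ ^ p = ε := by
    rw [hδ, ← Real.rpow_mul hε.le, one_div_mul_cancel hp0.ne', Real.rpow_one]
  refine ⟨(1 / δ) ^ (p / (p - 1)), by positivity, fun x y => ?_⟩
  have h := Real.young_inequality (δ * y) (x / δ) hpq
  calc x * y = δ * y * (x / δ) := by field_simp
    _ ≤ _ := h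
    _ ≤ |δ * y| ^ p + |x / δ| ^ (p / (p - 1)) := by
        gcongr
        · exact div_le_self (by positivity) hp.le
        · exact div_le_self (by positivity) hpq.symm.lt.le
    _ = _ := by
        rw [abs_mul, abs_of_pos hδ0, Real.mul_rpow hδ0.le (abs_nonneg _), hδp, div_eq_inv_mul x δ,
          abs_mul, abs_of_pos (inv_pos.2 hδ0), Real.mul_rpow (by positivity) (abs_nonneg _),
          one_div]

section Measure

variable {X : Type*} [MeasurableSpace X] {μ : Measure X}

lemma memLp_abs_rpow {g : X → ℝ} {r q : ℝ} (hq : 0 < q)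
    (hg : MemLp g (ENNReal.ofReal (r * q)) μ) :
    MemLp (fun x => |g x| ^ q) (ENNReal.ofReal r) μ := by
  have h := hg.norm_rpow_div (ENNReal.ofReal q)
  rw [← ENNReal.ofReal_div_of_pos hq, mul_div_cancel_right₀ _ hq.ne',
    ENNReal.toReal_ofReal hq.le] at h
  exact h

lemma memLp_mono_ofReal [IsFiniteMeasure μ] {g : X → ℝ} {r q : ℝ}
    (hg : MemLp g (ENNReal.ofReal q) μ) (hr : r ≤ q) : MemLp g (ENNReal.ofReal r) μ :=
  hg.mono_exponent (ENNReal.ofReal_le_ofReal hr)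

lemma integrable_abs_rpow {g : X → ℝ} {q : ℝ} (hq : 0 < q)
    (hg : MemLp g (ENNReal.ofReal q) μ) : Integrable (fun x => |g x| ^ q) μ := by
  have := memLp_abs_rpow (r := 1) hq (by rwa [one_mul])
  rwa [ENNReal.ofReal_one, memLp_one_iff_integrable] at this

lemma integrable_mul_conj {g k : X → ℝ} {q : ℝ} (hq : 1 < q)
    (hg : MemLp g (ENNReal.ofReal (q / (q - 1))) μ) (hk : MemLp k (ENNReal.ofReal q) μ) :
    Integrable (fun x => g x * k x) μ := by
  have hpq : (q / (q - 1)).HolderConjugate q := (Real.HolderConjugate.conjExponent hq).symm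
  have := hpq.ennrealOfReal
  exact hg.integrable_mul hk

/-- Hölder with exponents `1 / β` and `1 / (1 - β)`: the surplus integrability of `g` becomes the
power `β` of the measure of a set off which `κ` vanishes. -/
lemma integral_mul_le_measure_rpow [IsFiniteMeasure μ] {β : ℝ} (hβ0 : 0 < β) (hβ1 : β < 1)
    {g : X → ℝ} (hg0 : ∀ x, 0 ≤ g x) (hg : MemLp g (ENNReal.ofReal (1 / (1 - β))) μ)
    {κ : X → ℝ} (hκ : AEStronglyMeasurable κ μ) {M : ℝ} (hκ0 : ∀ x, 0 ≤ κ x)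
    (hκM : ∀ x, κ x ≤ M) {A : Set X} (hA : ∀ x, x ∉ A → κ x = 0) (hM : 0 ≤ M) :
    ∫ x, κ x * g x ∂μ ≤
      M * (∫ x, g x ^ (1 / (1 - β)) ∂μ) ^ (1 - β) * (μ A).toReal ^ β := by
  have hb : 0 < 1 - β := by linarith
  have hpq : (1 / β).HolderConjugate (1 / (1 - β)) := by
    rw [Real.holderConjugate_iff]
    refine ⟨by rw [lt_div_iff₀ hβ0]; linarith, by simp⟩
  have h := integral_mul_le_Lp_mul_Lq_of_nonneg hpq (Eventually.of_forall hκ0)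
    (Eventually.of_forall hg0)
    (MemLp.of_bound hκ M (Eventually.of_forall fun x => by
      rw [Real.norm_of_nonneg (hκ0 x)]; exact hκM x)) hg
  have h1 : ∫ x, κ x ^ (1 / β) ∂μ ≤ M ^ (1 / β) * (μ A).toReal := by
    have hle : ∫⁻ x, ENNReal.ofReal (κ x ^ (1 / β)) ∂μ ≤ ENNReal.ofReal (M ^ (1 / β)) * μ A := by
      -- Only the upper bound for the integral of an indicator is used, so `A` need not be
      -- measurable.
      refine le_trans (lintegral_mono fun x => ?_) (lintegral_indicator_const_le A _)
      by_cases hx : x ∈ A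
      · rw [Set.indicator_of_mem hx]
        exact ENNReal.ofReal_le_ofReal (Real.rpow_le_rpow (hκ0 x) (hκM x) (by positivity))
      · rw [hA x hx, Real.zero_rpow (by positivity)]
        simp
    rw [integral_eq_lintegral_of_nonneg_ae (Eventually.of_forall fun x =>
      Real.rpow_nonneg (hκ0 x) _) ((hκ.aemeasurable.pow_const _).aestronglyMeasurable)]
    refine (ENNReal.toReal_mono (ENNReal.mul_ne_top ENNReal.ofReal_ne_top
      (measure_ne_top μ A)) hle).trans (le_of_eq ?_)
    rw [ENNReal.toReal_mul, ENNReal.toReal_ofReal (by positivity)]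
  have h0 : 0 ≤ ∫ x, κ x ^ (1 / β) ∂μ := integral_nonneg fun x => Real.rpow_nonneg (hκ0 x) _
  have h2 : 0 ≤ ∫ x, g x ^ (1 / (1 - β)) ∂μ := integral_nonneg fun x => Real.rpow_nonneg (hg0 x) _
  rw [one_div_one_div, one_div_one_div] at h
  refine h.trans ?_
  calc _ ≤ (M ^ (1 / β) * (μ A).toReal) ^ β * (∫ x, g x ^ (1 / (1 - β)) ∂μ) ^ (1 - β) := by
        gcongr
    _ = _ := by
        rw [Real.mul_rpow (by positivity) ENNReal.toReal_nonneg, ← Real.rpow_mul hM,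
          one_div_mul_cancel hβ0.ne', Real.rpow_one]
        ring

/-- The energy estimate on the set where the cutoff is active. -/
lemma exists_energy_estimate {ι : Type*} [Fintype ι] {p : ι → ℝ} (hp : ∀ i, 1 < p i) {ν : ℝ}
    (hν : 0 < ν) : ∃ C : ι → ℝ, (∀ i, 0 ≤ C i) ∧ ∀ (N F : ι → X → ℝ) (R κ : X → ℝ) (M : ℝ),
      (∀ i, MemLp (N i) (ENNReal.ofReal (p i)) μ) →
      (∀ i, MemLp (F i) (ENNReal.ofReal (p i / (p i - 1))) μ) →
      AEStronglyMeasurable κ μ → (∀ x, 0 ≤ κ x) → (∀ x, κ x ≤ M) → Integrable R μ →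
      (∀ᵐ x ∂μ, R x ≤ ∑ i, F i x * N i x - ν * ∑ i, |N i x| ^ p i) →
      0 ≤ ∫ x, κ x * R x ∂μ →
      ∫ x, κ x * ∑ i, |N i x| ^ p i ∂μ ≤
        ∫ x, κ x * ∑ i, C i * |F i x| ^ (p i / (p i - 1)) ∂μ := by
  -- With parameter `ν / 2`, half of the coercive term absorbs the product `F i * N i`; the other
  -- half remains.
  choose C hC0 hC using fun i => exists_young (hp i) (half_pos hν)
  refine ⟨fun i => 2 / ν * C i, fun i => mul_nonneg (by positivity) (hC0 i), ?_⟩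
  intro N F R κ M hN hF hκ hκ0 hκM hR hRle hint
  have hκb : ∀ᵐ x ∂μ, ‖κ x‖ ≤ M := Eventually.of_forall fun x => by
    rw [Real.norm_of_nonneg (hκ0 x)]; exact hκM x
  have hp0 : ∀ i, 0 < p i := fun i => by linarith [hp i]
  have i1 : Integrable (fun x => κ x * ∑ i, |N i x| ^ p i) μ :=
    (integrable_finsetSum _ fun i _ => integrable_abs_rpow (hp0 i) (hN i)).bdd_mul hκ hκb
  have i2 : Integrable (fun x => κ x * ∑ i, C i * |F i x| ^ (p i / (p i - 1))) μ :=
    (integrable_finsetSum _ fun i _ => (integrable_abs_rpow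
      (div_pos (hp0 i) (by linarith [hp i])) (hF i)).const_mul (C i)).bdd_mul hκ hκb
  have h1 : ∫ x, κ x * R x ∂μ ≤ ∫ x, (κ x * ∑ i, C i * |F i x| ^ (p i / (p i - 1))) -
      ν / 2 * (κ x * ∑ i, |N i x| ^ p i) ∂μ := by
    refine integral_mono_ae (hR.bdd_mul hκ hκb) (i2.sub (i1.const_mul _)) ?_
    filter_upwards [hRle] with x hx
    have hs : ∑ i, F i x * N i x ≤
        ν / 2 * ∑ i, |N i x| ^ p i + ∑ i, C i * |F i x| ^ (p i / (p i - 1)) := by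
      rw [Finset.mul_sum, ← Finset.sum_add_distrib]
      exact Finset.sum_le_sum fun i _ => hC i _ _
    calc κ x * R x ≤ κ x * (∑ i, C i * |F i x| ^ (p i / (p i - 1)) -
          ν / 2 * ∑ i, |N i x| ^ p i) := by
          refine mul_le_mul_of_nonneg_left ?_ (hκ0 x)
          linarith
      _ = _ := by ring
  rw [integral_sub i2 (i1.const_mul _), integral_const_mul] at h1
  have h2 : ∫ x, κ x * ∑ i, 2 / ν * C i * |F i x| ^ (p i / (p i - 1)) ∂μ =
      2 / ν * ∫ x, κ x * ∑ i, C i * |F i x| ^ (p i / (p i - 1)) ∂μ := by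
    rw [← integral_const_mul]
    congr 1
    ext x
    simp only [mul_assoc, ← Finset.mul_sum]
    ring
  rw [h2, div_mul_eq_mul_div, le_div_iff₀ hν]
  linarith

end Measure

/-! ### Composition with Carathéodory functions -/

/-- For a simple function in place of `D` the composition is a finite sum of slices `a · z` cut off
to measurable fibres; continuity in `z` passes to the limit. -/
lemma IsCaratheodory.aestronglyMeasurable_comp {a : (Fin n → ℝ) → (Fin n → ℝ) → ℝ}
    (ha : IsCaratheodory Ω a) {D : Fin n → (Fin n → ℝ) → ℝ}
    (hD : ∀ j, AEStronglyMeasurable (D j) (volume.restrict Ω)) :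
    AEStronglyMeasurable (fun x => a x (fun j => D j x)) (volume.restrict Ω) := by
  have hv : AEStronglyMeasurable (fun x j => D j x) (volume.restrict Ω) :=
    (aemeasurable_pi_lambda _ fun j => (hD j).aemeasurable).aestronglyMeasurable
  obtain ⟨g, hg, hgv⟩ := hv
  refine aestronglyMeasurable_of_tendsto_ae atTop (f := fun m x => a x (hg.approx m x))
    (fun m => ?_) ?_
  · have : (fun x => a x (hg.approx m x)) = fun x => ∑ z ∈ (hg.approx m).range,
        (hg.approx m ⁻¹' {z}).indicator (fun x => a x z) x := by
      ext x
      rw [Finset.sum_eq_single (hg.approx m x)]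
      · simp
      · intro z _ hz
        exact Set.indicator_of_notMem (fun h => hz (by simpa using h.symm)) _
      · intro h
        exact absurd ((hg.approx m).mem_range_self x) h
    rw [this]
    refine Finset.aestronglyMeasurable_fun_sum _ fun z _ => ?_
    exact (ha.measurable z).indicator ((hg.approx m).measurableSet_fiber z)
  · filter_upwards [ha.continuous, hgv] with x hx hxv
    rw [hxv]
    exact (hx.tendsto _).comp (hg.tendsto_approx x)

/-- Integrability of `a_i(x, D(x))` from the growth condition. -/
lemma memLp_caratheodory_comp {p : Fin n → ℝ} (hp : ∀ k, 1 < p k)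
    {a : (Fin n → ℝ) → (Fin n → ℝ) → ℝ} (ha : IsCaratheodory Ω a) {i : Fin n}
    {h : (Fin n → ℝ) → ℝ} (h_nonneg : ∀ᵐ x ∂(volume.restrict Ω), 0 ≤ h x) {c : ℝ}
    (growth : ∀ᵐ x ∂(volume.restrict Ω), ∀ z : Fin n → ℝ,
      |a x z| ≤ c * (h x + ∑ j, |z j| ^ p j) ^ (1 - 1 / p i))
    {ρ : ℝ} (hh : MemLp h (ENNReal.ofReal ρ) (volume.restrict Ω)) {D : Fin n → (Fin n → ℝ) → ℝ}
    (hD : ∀ j, MemLp (D j) (ENNReal.ofReal (ρ * p j)) (volume.restrict Ω)) :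
    MemLp (fun x => a x (fun j => D j x)) (ENNReal.ofReal (ρ * (p i / (p i - 1))))
      (volume.restrict Ω) := by
  have hpi := hp i
  have hpi1 : 0 < p i - 1 := by linarith
  have hθ : 0 < 1 - 1 / p i := by
    rw [sub_pos, div_lt_one (by linarith)]
    exact hpi
  have hE : MemLp (fun x => h x + ∑ j, |D j x| ^ p j) (ENNReal.ofReal ρ) (volume.restrict Ω) :=
    hh.add (memLp_finsetSum _ fun j _ => memLp_abs_rpow (by linarith [hp j]) (hD j))
  have hE' := memLp_abs_rpow (g := fun x => h x + ∑ j, |D j x| ^ p j)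
    (r := ρ * (p i / (p i - 1))) hθ (by
      have h0 : p i ≠ 0 := by linarith
      have : ρ * (p i / (p i - 1)) * (1 - 1 / p i) = ρ := by
        field_simp
      rwa [this])
  refine hE'.of_le_mul (c := c) (ha.aestronglyMeasurable_comp fun j => (hD j).1) ?_
  filter_upwards [growth, h_nonneg] with x hx hx0
  have h0 : 0 ≤ h x + ∑ j, |D j x| ^ p j :=
    add_nonneg hx0 (Finset.sum_nonneg fun j _ => by positivity)
  have := hx fun j => D j x
  rwa [Real.norm_eq_abs, Real.norm_of_nonneg (by positivity), abs_of_nonneg h0]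

/-! ### Dyadic iteration -/

/-- Stampacchia's lemma for the dyadic iteration of an inequality with a sublinear power. -/
lemma exists_le_div_rpow_of_dyadic {φ : ℝ → ℝ} {V C s γ t : ℝ} (hφ0 : ∀ L, 0 < L → 0 ≤ φ L)
    (hφV : ∀ L, 0 < L → φ L ≤ V) (hC : 0 ≤ C) (hs : 0 < s) (hγ0 : 0 < γ) (hγ1 : γ < 1)
    (ht : t = s / (1 - γ)) (hstep : ∀ L, 0 < L → L ^ s * φ (2 * L) ≤ C * φ L ^ γ) :
    ∃ c : ℝ, 0 < c ∧ ∀ L, 0 < L → φ L ≤ c / L ^ t := by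
  have hg : 0 < 1 - γ := by linarith
  have ht0 : 0 < t := by rw [ht]; positivity
  have htγ : t = s + t * γ := by
    rw [ht]
    field_simp
    ring
  set K := 2 ^ t * C with hK
  have hK0 : 0 ≤ K := by positivity
  -- The term `max V 1` settles the levels `L ≤ 1`; the other gives `K c^γ ≤ c`, so the bound `c`
  -- reproduces itself when the level doubles.
  set c := max (max V 1) (K ^ (1 / (1 - γ))) with hc
  have hc0 : 0 < c := lt_of_lt_of_le one_pos ((le_max_right V 1).trans (le_max_left _ _))
  have hKc : K * c ^ γ ≤ c := by
    have h1 : K ≤ c ^ (1 - γ) := by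
      calc K = (K ^ (1 / (1 - γ))) ^ (1 - γ) := by
            rw [← Real.rpow_mul hK0, one_div_mul_cancel hg.ne', Real.rpow_one]
        _ ≤ _ := Real.rpow_le_rpow (by positivity) (le_max_right _ _) hg.le
    calc K * c ^ γ ≤ c ^ (1 - γ) * c ^ γ := by gcongr
      _ = c := by rw [← Real.rpow_add hc0]; simp
  have key : ∀ m : ℕ, ∀ L, 0 < L → L ≤ 2 ^ m → L ^ t * φ L ≤ c := by
    intro m
    induction m with
    | zero =>
      intro L hL hL1
      rw [pow_zero] at hL1
      calc L ^ t * φ L ≤ 1 * φ L := by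
            gcongr
            · exact hφ0 L hL
            · exact Real.rpow_le_one hL.le hL1 ht0.le
        _ = φ L := one_mul _
        _ ≤ V := hφV L hL
        _ ≤ c := (le_max_left V 1).trans (le_max_left _ _)
    | succ m ih =>
      intro L hL hLm
      have hL2 : 0 < L / 2 := by positivity
      have h1 := ih (L / 2) hL2 (by rw [pow_succ] at hLm; linarith)
      have h2 := hstep (L / 2) hL2
      rw [mul_div_cancel₀ _ (two_ne_zero' ℝ)] at h2
      calc L ^ t * φ L = 2 ^ t * ((L / 2) ^ (t * γ) * ((L / 2) ^ s * φ L)) := by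
            rw [← mul_assoc ((L / 2) ^ (t * γ)), ← Real.rpow_add hL2, add_comm, ← htγ,
              ← mul_assoc, ← Real.mul_rpow (by norm_num) hL2.le, mul_div_cancel₀ _ (two_ne_zero' ℝ)]
        _ ≤ 2 ^ t * ((L / 2) ^ (t * γ) * (C * φ (L / 2) ^ γ)) := by gcongr
        _ = K * ((L / 2) ^ t * φ (L / 2)) ^ γ := by
            rw [Real.mul_rpow (by positivity) (hφ0 _ hL2), ← Real.rpow_mul hL2.le, hK]
            ring
        _ ≤ K * c ^ γ := by
            have := hφ0 _ hL2
            gcongr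
        _ ≤ c := hKc
  refine ⟨c, hc0, fun L hL => ?_⟩
  obtain ⟨m, hm⟩ := pow_unbounded_of_one_lt L (one_lt_two (α := ℝ))
  rw [le_div_iff₀ (by positivity), mul_comm]
  exact key m L hL hm.le

/-! ### The obstacle problem and its level sets -/

/-- Testing the obstacle problem with `v = u - H(u - θ_*)`. -/
lemma IsObstacleSolution.integral_nonneg_of_cutoff {p : Fin n → ℝ} (hp : ∀ k, 1 < p k)
    {a : Fin n → (Fin n → ℝ) → (Fin n → ℝ) → ℝ} {f : Fin n → (Fin n → ℝ) → ℝ}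
    {θ θs u : (Fin n → ℝ) → ℝ} {ψ : (Fin n → ℝ) → EReal}
    (hsol : IsObstacleSolution Ω p ψ θ a f u)
    (hθs_eq : ∀ᵐ x ∂(volume.restrict Ω), (θs x : EReal) = max (ψ x) (θ x : EReal))
    {Gθ G₁ N : Fin n → (Fin n → ℝ) → ℝ}
    (hθ1 : MemLp θ 1 (volume.restrict Ω)) (hGθ : IsWeakGradient Ω θ Gθ)
    (hGθ1 : ∀ k, MemLp (Gθ k) 1 (volume.restrict Ω))
    (hGθp : ∀ k, MemLp (Gθ k) (ENNReal.ofReal (p k)) (volume.restrict Ω))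
    (hG₁ : IsW0Gradient Ω (fun x => u x - θ x) G₁)
    (hG₁p : ∀ k, MemLp (G₁ k) (ENNReal.ofReal (p k)) (volume.restrict Ω))
    (hN : IsW0Gradient Ω (fun x => u x - θs x) N)
    (hNp : ∀ k, MemLp (N k) (ENNReal.ofReal (p k)) (volume.restrict Ω))
    (hf : ∀ i, MemLp (f i) (ENNReal.ofReal (p i / (p i - 1))) (volume.restrict Ω))
    (ha : ∀ i, MemLp (fun x => a i x (fun j => Gθ j x + G₁ j x))
      (ENNReal.ofReal (p i / (p i - 1))) (volume.restrict Ω))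
    {H : ℝ → ℝ} (hH : ContDiff ℝ ((⊤ : ℕ∞) : WithTop ℕ∞) H) (hH0 : H 0 = 0) {M : ℝ}
    (hM : ∀ x, |deriv H x| ≤ M) (hpos : ∀ s, 0 ≤ s → H s ≤ s) (hneg : ∀ s, s ≤ 0 → H s ≤ 0) :
    0 ≤ ∫ x in Ω, deriv H (u x - θs x) *
      ∑ i, (f i x - a i x (fun j => Gθ j x + G₁ j x)) * N i x := by
  obtain ⟨⟨hu, huψ, -⟩, hsol⟩ := hsol
  have hcd : Continuous (deriv H) := (hH.of_le (by exact_mod_cast le_top)).continuous_deriv le_rfl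
  have hκ : AEStronglyMeasurable (fun x => deriv H (u x - θs x)) (volume.restrict Ω) :=
    hcd.comp_aestronglyMeasurable hN.memLp.1
  have hκM : ∀ᵐ x ∂(volume.restrict Ω), ‖deriv H (u x - θs x)‖ ≤ M :=
    Eventually.of_forall fun x => hM _
  have hcomp := hG₁.sub (hN.comp hH hH0 hM)
  have hcompp : ∀ k, MemLp (fun x => G₁ k x - deriv H (u x - θs x) * N k x)
      (ENNReal.ofReal (p k)) (volume.restrict Ω) := fun k =>
    (hG₁p k).sub ((hNp k).of_le_mul (c := M) (hκ.mul (hNp k).1)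
      (Eventually.of_forall fun x => by
        rw [norm_mul]
        exact mul_le_mul_of_nonneg_right (hM _) (norm_nonneg _)))
  have hDu := hGθ.add hG₁.isWeakGradient hθ1 hG₁.memLp hGθ1 hG₁.memLp_grad
  simp only [add_sub_cancel] at hDu
  have hDv := hGθ.add hcomp.isWeakGradient hθ1 hcomp.memLp hGθ1 hcomp.memLp_grad
  have hv1 := hθ1.add hcomp.memLp
  have hveq : (fun x => θ x + (u x - θ x - H (u x - θs x))) =
      fun x => u x - H (u x - θs x) := by
    ext x
    ring
  rw [hveq] at hDv
  have hv : (fun x => u x - H (u x - θs x)) ∈ obstacleClass Ω p ψ θ := by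
    refine ⟨⟨?_, _, hDv, fun k => (hGθ1 k).add (hcomp.memLp_grad k),
      fun k => (hGθp k).add (hcompp k)⟩, ?_, ?_⟩
    · rw [← hveq]
      exact hv1
    · filter_upwards [huψ, hθs_eq] with x hx hxs
      -- Where `u ≥ θ_*`, `H s ≤ s` keeps the competitor above `θ_* ≥ ψ`; where `u ≤ θ_*`, `H s ≤ 0`
      -- keeps it above `u ≥ ψ`.
      rcases le_total 0 (u x - θs x) with h | h
      · calc ψ x ≤ (θs x : EReal) := hxs ▸ le_max_left _ _
          _ ≤ _ := by
            rw [EReal.coe_le_coe_iff]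
            linarith [hpos _ h]
      · refine hx.trans ?_
        rw [EReal.coe_le_coe_iff]
        linarith [hneg _ h]
    · have := hcomp.memW0 hcompp
      convert this using 2
      ring
  have key := hsol _ hv _ _ hDu hDv
  have hdiff : ∀ (g : Fin n → (Fin n → ℝ) → ℝ) (x : Fin n → ℝ),
      ∑ i, g i x * (Gθ i x + (G₁ i x - deriv H (u x - θs x) * N i x) - (Gθ i x + G₁ i x)) =
        -(deriv H (u x - θs x) * ∑ i, g i x * N i x) := fun g x => by
    rw [Finset.mul_sum, ← Finset.sum_neg_distrib]
    exact Finset.sum_congr rfl fun i _ => by ring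
  simp only [hdiff f, hdiff fun i x => a i x (fun j => Gθ j x + G₁ j x)] at key
  rw [integral_neg, integral_neg, neg_le_neg_iff, ← sub_nonneg] at key
  rw [← integral_sub] at key
  · refine key.trans (le_of_eq (integral_congr_ae (Eventually.of_forall fun x => ?_)))
    simp only [sub_mul, Finset.sum_sub_distrib, mul_sub]
  · exact (integrable_finsetSum _ fun i _ =>
      integrable_mul_conj (hp i) (hf i) (hNp i)).bdd_mul hκ hκM
  · exact (integrable_finsetSum _ fun i _ =>
      integrable_mul_conj (hp i) (ha i) (hNp i)).bdd_mul hκ hκM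

/-- The inequality between the measures of the level sets of `u - θ_*` at levels `L` and `2L`. -/
lemma IsObstacleSolution.exists_level_set_estimate (hn : 2 ≤ n) (hΩ_bdd : Bornology.IsBounded Ω)
    {p q : Fin n → ℝ} (hp : ∀ k, 1 < p k)
    {a : Fin n → (Fin n → ℝ) → (Fin n → ℝ) → ℝ} (ha : ∀ i, IsCaratheodory Ω (a i))
    {h : (Fin n → ℝ) → ℝ} (h_nonneg : ∀ᵐ x ∂(volume.restrict Ω), 0 ≤ h x) {c₁ : ℝ}
    (growth : ∀ᵐ x ∂(volume.restrict Ω), ∀ z : Fin n → ℝ, ∀ i,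
      |a i x z| ≤ c₁ * (h x + ∑ j, |z j| ^ p j) ^ (1 - 1 / p i))
    {ν : ℝ} (hν : 0 < ν)
    (monotone : ∀ᵐ x ∂(volume.restrict Ω), ∀ z z' : Fin n → ℝ,
      ν * ∑ i, |z i - z' i| ^ p i ≤ ∑ i, (a i x z - a i x z') * (z i - z' i))
    {θ θs u : (Fin n → ℝ) → ℝ} (hθ : MemW Ω q θ) {ψ : (Fin n → ℝ) → EReal}
    (hθs_eq : ∀ᵐ x ∂(volume.restrict Ω), (θs x : EReal) = max (ψ x) (θ x : EReal))
    (hθs : MemW0 Ω q (fun x => θs x - θ x)) {β : ℝ} (hβ0 : 0 < β) (hβ1 : β < 1)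
    (hh : MemLp h (ENNReal.ofReal (1 / (1 - β))) (volume.restrict Ω))
    (hpq : ∀ j, 1 / (1 - β) * p j ≤ q j) {f : Fin n → (Fin n → ℝ) → ℝ}
    (hf : ∀ i, MemLp (f i) (ENNReal.ofReal (1 / (1 - β) * (p i / (p i - 1))))
      (volume.restrict Ω))
    (hP : 1 < ∑ k, 1 / p k) {s : ℝ} (hs : s = n / (∑ k, 1 / p k - 1))
    (hsol : IsObstacleSolution Ω p ψ θ a f u) :
    ∃ C : ℝ, 0 ≤ C ∧ ∀ L, 0 < L →
      L ^ s * ((volume.restrict Ω) {x | 2 * L < |u x - θs x|}).toReal ≤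
        C * ((volume.restrict Ω) {x | L < |u x - θs x|}).toReal ^
          (β * ((∑ k, 1 / p k) / (∑ k, 1 / p k - 1))) := by
  have hΩ : volume Ω ≠ ⊤ := hΩ_bdd.measure_lt_top.ne
  have : IsFiniteMeasure (volume.restrict Ω) := ⟨by simpa using hΩ.lt_top⟩
  set P := ∑ k, 1 / p k with hPdef
  have hs0 : 0 < s := by
    rw [hs]
    have : (2 : ℝ) ≤ n := by exact_mod_cast hn
    exact div_pos (by linarith) (by linarith)
  have hρ : 1 ≤ 1 / (1 - β) := by
    rw [le_div_iff₀ (by linarith)]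
    linarith
  have hp0 : ∀ k, 0 < p k := fun k => by linarith [hp k]
  have hp' : ∀ k, 0 < p k / (p k - 1) := fun k => div_pos (hp0 k) (by linarith [hp k])
  obtain ⟨hθ1, Gθ, hGθ, hGθ1, hGθq⟩ := hθ
  obtain ⟨G₂, hG₂, hG₂q⟩ := hθs.exists_isW0Gradient
  obtain ⟨G₁, hG₁, hG₁p⟩ := hsol.1.2.2.exists_isW0Gradient
  have hpq' : ∀ k, p k ≤ q k := fun k =>
    (le_mul_of_one_le_left (hp0 k).le hρ).trans (hpq k)
  have hGθp := fun k => memLp_mono_ofReal (hGθq k) (hpq' k)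
  have hG₂p := fun k => memLp_mono_ofReal (hG₂q k) (hpq' k)
  set N : Fin n → (Fin n → ℝ) → ℝ := fun k x => G₁ k x - G₂ k x with hNdef
  have hN : IsW0Gradient Ω (fun x => u x - θs x) N := by
    have := hG₁.sub hG₂
    simpa only [sub_sub_sub_cancel_right] using this
  have hNp : ∀ k, MemLp (N k) (ENNReal.ofReal (p k)) (volume.restrict Ω) := fun k =>
    (hG₁p k).sub (hG₂p k)
  have growth' : ∀ i, ∀ᵐ x ∂(volume.restrict Ω), ∀ z : Fin n → ℝ,
      |a i x z| ≤ c₁ * (h x + ∑ j, |z j| ^ p j) ^ (1 - 1 / p i) := fun i => by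
    filter_upwards [growth] with x hx z using hx z i
  have hau : ∀ i, MemLp (fun x => a i x (fun j => Gθ j x + G₁ j x))
      (ENNReal.ofReal (p i / (p i - 1))) (volume.restrict Ω) := fun i => by
    have := memLp_caratheodory_comp hp (ha i) h_nonneg (growth' i) (memLp_mono_ofReal hh hρ)
      (D := fun j x => Gθ j x + G₁ j x) fun j => by
        rw [one_mul]
        exact (hGθp j).add (hG₁p j)
    rwa [one_mul] at this
  -- Unlike `Du`, the gradient of `θ_*` is in `L^{q_j}` with `q_j ≥ p_j / (1 - β)`. This surplus is
  -- the source of the power `β`.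
  have has : ∀ i, MemLp (fun x => a i x (fun j => Gθ j x + G₂ j x))
      (ENNReal.ofReal (1 / (1 - β) * (p i / (p i - 1)))) (volume.restrict Ω) := fun i =>
    memLp_caratheodory_comp hp (ha i) h_nonneg (growth' i) hh
      (D := fun j x => Gθ j x + G₂ j x)
      fun j => memLp_mono_ofReal ((hGθq j).add (hG₂q j)) (hpq j)
  set F : Fin n → (Fin n → ℝ) → ℝ := fun i x => f i x - a i x (fun j => Gθ j x + G₂ j x)
  have hF : ∀ i, MemLp (F i) (ENNReal.ofReal (1 / (1 - β) * (p i / (p i - 1))))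
      (volume.restrict Ω) := fun i => (hf i).sub (has i)
  have hle : ∀ i, p i / (p i - 1) ≤ 1 / (1 - β) * (p i / (p i - 1)) := fun i =>
    le_mul_of_one_le_left (hp' i).le hρ
  have hf' := fun i => memLp_mono_ofReal (hf i) (hle i)
  set R : (Fin n → ℝ) → ℝ := fun x =>
    ∑ i, (f i x - a i x (fun j => Gθ j x + G₁ j x)) * N i x
  have hR : Integrable R (volume.restrict Ω) := integrable_finsetSum _ fun i _ =>
    integrable_mul_conj (hp i) ((hf' i).sub (hau i)) (hNp i)
  have hRle : ∀ᵐ x ∂(volume.restrict Ω),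
      R x ≤ ∑ i, F i x * N i x - ν * ∑ i, |N i x| ^ p i := by
    filter_upwards [monotone] with x hx
    have h1 := hx (fun j => Gθ j x + G₁ j x) (fun j => Gθ j x + G₂ j x)
    simp only [add_sub_add_left_eq_sub] at h1
    have h2 : R x = ∑ i, F i x * N i x - ∑ i, (a i x (fun j => Gθ j x + G₁ j x) -
        a i x (fun j => Gθ j x + G₂ j x)) * (G₁ i x - G₂ i x) := by
      rw [← Finset.sum_sub_distrib]
      refine Finset.sum_congr rfl fun i _ => ?_
      simp only [F, N]
      ring
    rw [h2]
    simp only [hNdef]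
    linarith
  obtain ⟨M, hM1, hcut⟩ := exists_cutoff
  obtain ⟨Ce, hCe0, hCe⟩ := exists_energy_estimate (μ := volume.restrict Ω) hp hν
  obtain ⟨Cs, hCs0, hCs⟩ := exists_anisotropic_sobolev (Ω := Ω) hn hp hP hs hΩ
  set g : (Fin n → ℝ) → ℝ := fun x => ∑ i, Ce i * |F i x| ^ (p i / (p i - 1))
  have hg0 : ∀ x, 0 ≤ g x := fun x => Finset.sum_nonneg fun i _ => mul_nonneg (hCe0 i)
    (by positivity)
  have hg : MemLp g (ENNReal.ofReal (1 / (1 - β))) (volume.restrict Ω) :=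
    memLp_finsetSum _ fun i _ => (memLp_abs_rpow (hp' i) (hF i)).const_mul (Ce i)
  set I := (∫ x in Ω, g x ^ (1 / (1 - β))) ^ (1 - β)
  have hI0 : 0 ≤ I := Real.rpow_nonneg (integral_nonneg fun x => Real.rpow_nonneg (hg0 x) _) _
  -- `Q` is a crude common bound for the exponents `p_k - 1`; `I + 1` replaces `I` so that `E` is
  -- positive.
  set Q := ∑ k, p k
  set E := M ^ Q * (M * (I + 1))
  have hM0 : 0 < M := by linarith
  have hE0 : 0 < E := by positivity
  refine ⟨Cs * E ^ (P / (P - 1)), by positivity, fun L hL => ?_⟩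
  set φ := ((volume.restrict Ω) {x | L < |u x - θs x|}).toReal
  -- The Sobolev lemma asks for a positive gradient bound `m`, so a null level set is treated apart.
  rcases (ENNReal.toReal_nonneg : 0 ≤ φ).eq_or_lt with hφ | hφ
  · have hz : (volume.restrict Ω) {x | L < |u x - θs x|} = 0 := by
      have := (ENNReal.toReal_eq_zero_iff _).1 hφ.symm
      exact this.resolve_right (measure_ne_top _ _)
    have : (volume.restrict Ω) {x | 2 * L < |u x - θs x|} = 0 := by
      refine measure_mono_null (fun x hx => ?_) hz
      simp only [Set.mem_ofPred_eq] at hx ⊢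
      linarith
    rw [this, ENNReal.toReal_zero, mul_zero]
    have : 0 ≤ φ := hφ.le
    positivity
  obtain ⟨H, hH, hHL, hH'0, hH'M, hH'z, hH2L, hH0, hHpos, hHneg⟩ := hcut L hL
  have hH'abs : ∀ x, |deriv H x| ≤ M := fun x => by
    rw [abs_of_nonneg (hH'0 x)]
    exact hH'M x
  have hcd : Continuous (deriv H) := (hH.of_le (by exact_mod_cast le_top)).continuous_deriv le_rfl
  set κ : (Fin n → ℝ) → ℝ := fun x => deriv H (u x - θs x)
  have hκ : AEStronglyMeasurable κ (volume.restrict Ω) :=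
    hcd.comp_aestronglyMeasurable hN.memLp.1
  have htest := hsol.integral_nonneg_of_cutoff hp hθs_eq hθ1 hGθ hGθ1 hGθp hG₁ hG₁p hN hNp hf' hau
    hH hH0 hH'abs hHpos hHneg
  have henergy := hCe N F R κ M hNp (fun i => memLp_mono_ofReal (hF i) (hle i)) hκ
    (fun x => hH'0 _) (fun x => hH'M _) hR hRle htest
  have hhold := integral_mul_le_measure_rpow hβ0 hβ1 hg0 hg hκ (fun x => hH'0 _)
    (fun x => hH'M _) (A := {x | L < |u x - θs x|}) (fun x hx => hH'z _ (not_lt.1 hx)) hM0.le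
  set m := E * φ ^ β with hm
  have hm0 : 0 < m := mul_pos hE0 (Real.rpow_pos_of_pos hφ _)
  have hbound : M ^ Q * ∫ x in Ω, κ x * ∑ i, |N i x| ^ p i ≤ m := by
    calc _ ≤ M ^ Q * (M * I * φ ^ β) := by
          gcongr
          exact henergy.trans hhold
      _ ≤ M ^ Q * (M * (I + 1) * φ ^ β) := by
          gcongr
          linarith
      _ = m := by rw [hm]; ring
  have hgrad : ∀ k, ∫⁻ x in Ω, ‖κ x * N k x‖ₑ ^ p k ≤ ENNReal.ofReal m := by
    intro k
    have hint : Integrable (fun x => M ^ Q * (κ x * ∑ i, |N i x| ^ p i)) (volume.restrict Ω) :=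
      ((integrable_finsetSum _ fun i _ => integrable_abs_rpow (hp0 i) (hNp i)).bdd_mul hκ
        (Eventually.of_forall fun x => hH'abs _)).const_mul _
    calc _ ≤ ∫⁻ x in Ω, ENNReal.ofReal (M ^ Q * (κ x * ∑ i, |N i x| ^ p i)) := by
          refine lintegral_mono fun x => ?_
          have hκ0 : 0 ≤ κ x := hH'0 _
          rw [Real.enorm_eq_ofReal_abs, ENNReal.ofReal_rpow_of_nonneg (abs_nonneg _) (hp0 k).le]
          refine ENNReal.ofReal_le_ofReal ?_
          rw [abs_mul, Real.mul_rpow (abs_nonneg _) (abs_nonneg _), abs_of_nonneg hκ0, ← mul_assoc]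
          have hsum : |N k x| ^ p k ≤ ∑ i, |N i x| ^ p i :=
            Finset.single_le_sum (f := fun i => |N i x| ^ p i)
              (fun i _ => Real.rpow_nonneg (abs_nonneg _) _) (Finset.mem_univ k)
          have hpQ : p k - 1 ≤ Q := by
            have : p k ≤ Q := Finset.single_le_sum (f := p) (fun i _ => (hp0 i).le)
              (Finset.mem_univ k)
            linarith
          -- The energy carries the factor `κ` to the first power, while `|D_k H(w)|^{p_k}` carries
          -- `κ ^ p k`; since `0 ≤ κ ≤ M`, the excess is a constant.
          have hκp : κ x ^ p k ≤ M ^ Q * κ x := by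
            calc κ x ^ p k = κ x ^ (p k - 1) * κ x := by
                  conv_lhs => rw [← sub_add_cancel (p k) 1]
                  rw [Real.rpow_add_one' hκ0 (by linarith [hp0 k])]
              _ ≤ M ^ (p k - 1) * κ x := by
                  gcongr
                  · linarith [hp k]
                  · exact hH'M _
              _ ≤ M ^ Q * κ x := by gcongr
          gcongr
      _ = ENNReal.ofReal (∫ x in Ω, M ^ Q * (κ x * ∑ i, |N i x| ^ p i)) := by
          refine (ofReal_integral_eq_lintegral_ofReal hint (Eventually.of_forall fun x => ?_)).symm
          exact mul_nonneg (by positivity) (mul_nonneg (hH'0 _)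
            (Finset.sum_nonneg fun i _ => by positivity))
      _ ≤ _ := by
          rw [integral_const_mul]
          exact ENNReal.ofReal_le_ofReal hbound
  obtain ⟨ξ, hξ, hξae, hξt⟩ := hN.exists_comp_approx hH hH0 hH'abs
  have hsob := hCs (fun j x => H (ξ j x)) (fun x => H (u x - θs x)) (fun k x => κ x * N k x) L m hm0
    hξ (fun j x => hHL _) (fun x => hHL _) (hN.comp hH hH0 hH'abs).memLp_grad hξae hξt hgrad
  -- Chebyshev: `|H(w)| = L` on the set where `|w| > 2L`.
  have hcheb : ENNReal.ofReal (L ^ s) * (volume.restrict Ω) {x | 2 * L < |u x - θs x|} ≤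
      ENNReal.ofReal (Cs * m ^ (P / (P - 1))) := by
    refine le_trans ?_ hsob
    refine le_trans ?_ (mul_meas_ge_le_lintegral₀
      ((hN.comp hH hH0 hH'abs).memLp.1.enorm.pow_const s) (ENNReal.ofReal (L ^ s)))
    gcongr
    intro hx
    rw [Real.enorm_eq_ofReal_abs, hH2L _ hx.le, ENNReal.ofReal_rpow_of_pos hL]
  have hfin := ENNReal.toReal_mono ENNReal.ofReal_ne_top hcheb
  rw [ENNReal.toReal_mul, ENNReal.toReal_ofReal (by positivity),
    ENNReal.toReal_ofReal (by positivity)] at hfin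
  refine hfin.trans (le_of_eq ?_)
  rw [hm, Real.mul_rpow hE0.le (by positivity), ← Real.rpow_mul hφ.le, mul_assoc]

/-! ### Arithmetic of the exponents -/

lemma harmonicMean_eq (p : Fin n → ℝ) : harmonicMean p = n / ∑ k, 1 / p k := by
  rw [harmonicMean, mul_inv, one_div, inv_inv, div_eq_mul_inv]

lemma one_lt_sum_of_harmonicMean_lt (hn : 2 ≤ n) {p : Fin n → ℝ} (hp : ∀ k, 1 < p k)
    (h : harmonicMean p < n) : 1 < ∑ k, 1 / p k := by
  have hn0 : (0 : ℝ) < n := by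
    have : (2 : ℝ) ≤ n := by exact_mod_cast hn
    linarith
  have hP : 0 < ∑ k, 1 / p k := Finset.sum_pos
    (fun k _ => one_div_pos.2 (by linarith [hp k])) ⟨⟨0, by omega⟩, Finset.mem_univ _⟩
  rw [harmonicMean_eq, div_lt_iff₀ hP] at h
  exact (lt_mul_iff_one_lt_right hn0).1 h

lemma sobolevConj_harmonicMean (hn : 2 ≤ n) {p : Fin n → ℝ} (hP : 1 < ∑ k, 1 / p k) :
    sobolevConj n (harmonicMean p) = n / (∑ k, 1 / p k - 1) := by
  have hn0 : (0 : ℝ) < n := by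
    have : (2 : ℝ) ≤ n := by exact_mod_cast hn
    linarith
  rw [harmonicMean_eq, sobolevConj]
  set P := ∑ k, 1 / p k
  have h1 : P ≠ 0 := by linarith
  have h2 : P - 1 ≠ 0 := by linarith
  have h3 : (n : ℝ) - n / P = n * (P - 1) / P := by field_simp
  rw [h3]
  field_simp

/-- The exponent `β = b p_m / (p_m - 1)` is compatible with all integrability exponents. -/
lemma exponent_bounds (hn : 2 ≤ n) {p q : Fin n → ℝ} (hp : ∀ k, 1 < p k)
    (hpq : ∀ k, p k < q k) {b : ℝ} (hb_pos : 0 < b)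
    (hb_le : b ≤ (⨅ j, (1 - p j / q j)) * (⨅ i, (1 - 1 / p i))) {β : ℝ}
    (hβ : β = b * ((⨆ k, p k) / ((⨆ k, p k) - 1))) (hβ1 : β < 1) :
    (∀ j, 1 / (1 - β) * p j ≤ q j) ∧ (1 / (1 - β) ≤ ⨆ k, q k / p k) ∧
    ∀ i, 1 / (1 - β) * (p i / (p i - 1)) ≤ p i / (p i - 1 - b * p i) := by
  have : Nonempty (Fin n) := ⟨⟨0, by omega⟩⟩
  have hβ1' : 0 < 1 - β := by linarith
  obtain ⟨k₀, hk₀⟩ := exists_eq_ciSup_of_finite (f := p)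
  set pm := ⨆ k, p k
  have hpm1 : 1 < pm := hk₀ ▸ hp k₀
  have hle : ∀ k, p k ≤ pm := le_ciSup (Set.finite_range p).bddAbove
  have hA : ∀ j, (⨅ j, (1 - p j / q j)) ≤ 1 - p j / q j := ciInf_le (Set.finite_range _).bddBelow
  have hB : ∀ i, (⨅ i, (1 - 1 / p i)) ≤ 1 - 1 / p i := ciInf_le (Set.finite_range _).bddBelow
  set A := ⨅ j, (1 - p j / q j)
  set B := ⨅ i, (1 - 1 / p i)
  have hB0 : 0 < B := by
    obtain ⟨i₀, hi₀⟩ := exists_eq_ciInf_of_finite (f := fun i => 1 - 1 / p i)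
    have : 0 < 1 - 1 / p i₀ := by
      rw [sub_pos, div_lt_one (by linarith [hp i₀])]
      exact hp i₀
    exact this.trans_eq hi₀
  have hA0 : 0 < A := pos_of_mul_pos_left (hb_pos.trans_le hb_le) hB0.le
  -- `B ≤ 1 - 1 / p_m` cancels the factor `p_m / (p_m - 1)` in `β`.
  have hβA : β ≤ A := by
    have h1 : B ≤ (pm - 1) / pm := by
      refine (hB k₀).trans (le_of_eq ?_)
      rw [hk₀]
      field_simp
    calc β ≤ A * ((pm - 1) / pm) * (pm / (pm - 1)) := by
          rw [hβ]
          have : 0 < pm - 1 := by linarith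
          gcongr
          exact hb_le.trans (by gcongr)
      _ = A := by
          have : pm - 1 ≠ 0 := by linarith
          field_simp
  have hq : ∀ j, 1 / (1 - β) * p j ≤ q j := fun j => by
    have hq0 : 0 < q j := by linarith [hp j, hpq j]
    have h1 := hβA.trans (hA j)
    have h2 : p j / q j ≤ 1 - β := by linarith
    rw [div_le_iff₀ hq0] at h2
    rw [one_div_mul_eq_div, div_le_iff₀ hβ1']
    linarith
  refine ⟨hq, ?_, fun i => ?_⟩
  · refine le_trans ?_ (le_ciSup (f := fun k => q k / p k) (Set.finite_range _).bddAbove k₀)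
    rw [le_div_iff₀ (by linarith [hp k₀])]
    exact hq k₀
  · have hpi := hp i
    have hpi1 : 0 < p i - 1 := by linarith
    have hbi : b < 1 - 1 / p i := by
      have hA1 : A < 1 := by
        refine (hA i).trans_lt ?_
        have : 0 < p i / q i := div_pos (by linarith) (by linarith [hpq i])
        linarith
      calc b ≤ A * B := hb_le
        _ < 1 * B := by gcongr
        _ ≤ _ := by rw [one_mul]; exact hB i
    have hden : 0 < p i - 1 - b * p i := by
      have h0 : 0 < p i := by linarith
      have := mul_lt_mul_of_pos_right hbi h0
      rw [sub_mul, one_mul, one_div_mul_cancel h0.ne'] at this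
      linarith
    rw [div_mul_div_comm, one_mul]
    refine div_le_div_of_nonneg_left (by linarith) hden ?_
    -- `r / (r - 1)` decreases in `r`, and `p i ≤ p_m`.
    have hmono : (p i - 1) * (pm / (pm - 1)) ≤ p i := by
      rw [mul_div_assoc', div_le_iff₀ (by linarith)]
      nlinarith [hle i]
    have : (p i - 1) * β ≤ b * p i := by
      calc (p i - 1) * β = b * ((p i - 1) * (pm / (pm - 1))) := by rw [hβ]; ring
        _ ≤ b * p i := by gcongr
    nlinarith

end AnisoObstacle

/-! ### The main theorem -/

theorem theorem1p1 {n : ℕ} (hn : 2 ≤ n)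
    -- the domain
    (Ω : Set (Fin n → ℝ)) (hΩ_open : IsOpen Ω) (hΩ_bdd : Bornology.IsBounded Ω)
    -- the exponents
    (p q : Fin n → ℝ) (hp : ∀ k, 1 < p k) (hpq : ∀ k, p k < q k)
    (hpbar : AnisoObstacle.harmonicMean p < n)
    -- the operator: growth and monotonicity
    (a : Fin n → (Fin n → ℝ) → (Fin n → ℝ) → ℝ)
    (ha : ∀ i, AnisoObstacle.IsCaratheodory Ω (a i))
    (h : (Fin n → ℝ) → ℝ) (h_nonneg : ∀ᵐ x ∂(MeasureTheory.volume.restrict Ω), 0 ≤ h x)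
    (h_memLp : MeasureTheory.MemLp h (ENNReal.ofReal (⨆ k, q k / p k))
      (MeasureTheory.volume.restrict Ω))
    (c₁ : ℝ) (hc₁ : 0 < c₁)
    (growth : ∀ᵐ x ∂(MeasureTheory.volume.restrict Ω), ∀ z : Fin n → ℝ, ∀ i,
      |a i x z| ≤ c₁ * (h x + ∑ j, |z j| ^ p j) ^ (1 - 1 / p i))
    (ν : ℝ) (hν : 0 < ν)
    (monotone : ∀ᵐ x ∂(MeasureTheory.volume.restrict Ω), ∀ z z' : Fin n → ℝ,
      ν * ∑ i, |z i - z' i| ^ p i ≤ ∑ i, (a i x z - a i x z') * (z i - z' i))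
    -- the boundary datum `θ`, the obstacle `ψ`, and `θ_* = max {ψ, θ}`
    (θ : (Fin n → ℝ) → ℝ) (hθ : AnisoObstacle.MemW Ω q θ)
    (ψ : (Fin n → ℝ) → EReal)
    (θs : (Fin n → ℝ) → ℝ)
    (hθs_eq : ∀ᵐ x ∂(MeasureTheory.volume.restrict Ω),
      (θs x : EReal) = max (ψ x) (θ x : EReal))
    (hθs : AnisoObstacle.MemW0 Ω q (fun x => θs x - θ x))
    -- the parameter `b`
    (b : ℝ) (hb_pos : 0 < b)
    (hb_le : b ≤ (⨅ j, (1 - p j / q j)) * (⨅ i, (1 - 1 / p i)))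
    (hb_lt : b < ((⨆ k, p k) - 1) / (⨆ k, p k) *
      (AnisoObstacle.harmonicMean p /
        AnisoObstacle.sobolevConj n (AnisoObstacle.harmonicMean p)))
    -- the right-hand side
    (f : Fin n → (Fin n → ℝ) → ℝ)
    (hf : ∀ i, MeasureTheory.MemLp (f i) (ENNReal.ofReal (p i / (p i - 1 - b * p i)))
      (MeasureTheory.volume.restrict Ω))
    -- the exponent `t`
    (t : ℝ)
    (ht : t = AnisoObstacle.sobolevConj n (AnisoObstacle.harmonicMean p) /
      (1 - b * AnisoObstacle.sobolevConj n (AnisoObstacle.harmonicMean p) /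
        AnisoObstacle.harmonicMean p * ((⨆ k, p k) / ((⨆ k, p k) - 1)))) :
    AnisoObstacle.sobolevConj n (AnisoObstacle.harmonicMean p) < t ∧
    ∀ u : (Fin n → ℝ) → ℝ, AnisoObstacle.IsObstacleSolution Ω p ψ θ a f u →
      AnisoObstacle.MemWeakLp Ω t (fun x => u x - θs x) := by
  have hP := AnisoObstacle.one_lt_sum_of_harmonicMean_lt hn hp hpbar
  have hSe := AnisoObstacle.sobolevConj_harmonicMean hn hP
  have hHe := AnisoObstacle.harmonicMean_eq p
  have hn0 : (0 : ℝ) < n := by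
    have : (2 : ℝ) ≤ n := by exact_mod_cast hn
    linarith
  have : Nonempty (Fin n) := ⟨⟨0, by omega⟩⟩
  have hpm1 : 1 < ⨆ k, p k := (hp ⟨0, by omega⟩).trans_le
    (le_ciSup (f := p) (Set.finite_range p).bddAbove _)
  have hratio : AnisoObstacle.harmonicMean p /
      AnisoObstacle.sobolevConj n (AnisoObstacle.harmonicMean p) =
      (∑ k, 1 / p k - 1) / ∑ k, 1 / p k := by
    rw [hSe, hHe]
    have : ∑ k, 1 / p k ≠ 0 := by linarith
    have : ∑ k, 1 / p k - 1 ≠ 0 := by linarith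
    field_simp
  rw [hratio] at hb_lt
  have hratio' : b * AnisoObstacle.sobolevConj n (AnisoObstacle.harmonicMean p) /
      AnisoObstacle.harmonicMean p * ((⨆ k, p k) / ((⨆ k, p k) - 1)) =
      b * ((⨆ k, p k) / ((⨆ k, p k) - 1)) *
        ((∑ k, 1 / p k) / (∑ k, 1 / p k - 1)) := by
    rw [← inv_div (∑ k, 1 / p k - 1), ← hratio, inv_div]
    ring
  rw [hratio'] at ht
  obtain ⟨β, hβ⟩ : ∃ β, β = b * ((⨆ k, p k) / ((⨆ k, p k) - 1)) := ⟨_, rfl⟩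
  obtain ⟨pm, hpm⟩ : ∃ pm, pm = ⨆ k, p k := ⟨_, rfl⟩
  obtain ⟨P, hPdef⟩ : ∃ P, P = ∑ k, 1 / p k := ⟨_, rfl⟩
  obtain ⟨s, hsdef⟩ : ∃ s, s = AnisoObstacle.sobolevConj n (AnisoObstacle.harmonicMean p) :=
    ⟨_, rfl⟩
  have hP1 : 1 < P := hPdef ▸ hP
  have hpm1' : 1 < pm := hpm ▸ hpm1
  have hβ0 : 0 < β := by
    rw [hβ]
    exact mul_pos hb_pos (div_pos (by linarith) (by linarith))
  -- The strict bound on `b`, rewritten with `p̄ / p̄* = (P - 1) / P`; it makes the iteration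
  -- sublinear.
  have hβP : β < (P - 1) / P := by
    rw [← hpm, ← hPdef] at hb_lt
    rw [hβ, ← hpm]
    have h1 : 0 < pm / (pm - 1) := div_pos (by linarith) (by linarith)
    calc b * (pm / (pm - 1)) < (pm - 1) / pm * ((P - 1) / P) * (pm / (pm - 1)) := by gcongr
      _ = (P - 1) / P := by
        have : pm - 1 ≠ 0 := by linarith
        field_simp
  have hβ1 : β < 1 := hβP.trans (by rw [div_lt_one (by linarith)]; linarith)
  have hγ0 : 0 < β * (P / (P - 1)) := mul_pos hβ0 (div_pos (by linarith) (by linarith))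
  have hγ1 : β * (P / (P - 1)) < 1 := by
    have : 0 < P / (P - 1) := div_pos (by linarith) (by linarith)
    calc β * (P / (P - 1)) < (P - 1) / P * (P / (P - 1)) := by gcongr
      _ = 1 := by
        have : P - 1 ≠ 0 := by linarith
        field_simp
  have hs0 : 0 < s := by
    rw [hsdef, hSe, ← hPdef]
    exact div_pos hn0 (by linarith)
  rw [← hβ, ← hPdef, ← hsdef] at ht
  obtain ⟨hq, hτ, hr⟩ := AnisoObstacle.exponent_bounds hn hp hpq hb_pos hb_le hβ hβ1
  have hfin : MeasureTheory.IsFiniteMeasure (MeasureTheory.volume.restrict Ω) :=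
    ⟨by simpa using hΩ_bdd.measure_lt_top⟩
  rw [← hsdef]
  refine ⟨?_, fun u hu => ⟨?_, ?_⟩⟩
  · rw [ht, lt_div_iff₀ (by linarith)]
    have := mul_pos hs0 hγ0
    linarith
  · obtain ⟨G₁, hG₁, -⟩ := hu.1.2.2.exists_isW0Gradient
    obtain ⟨G₂, hG₂, -⟩ := hθs.exists_isW0Gradient
    simpa only [sub_sub_sub_cancel_right] using (hG₁.sub hG₂).memLp.1
  · obtain ⟨C, hC0, hC⟩ := hu.exists_level_set_estimate hn hΩ_bdd hp ha h_nonneg growth hν monotone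
      hθ hθs_eq hθs hβ0 hβ1 (AnisoObstacle.memLp_mono_ofReal h_memLp hτ) hq
      (fun i => AnisoObstacle.memLp_mono_ofReal (hf i) (hr i)) hP (hsdef.trans hSe)
    rw [← hPdef] at hC
    obtain ⟨c, hc0, hc⟩ := AnisoObstacle.exists_le_div_rpow_of_dyadic
      (φ := fun L => ((MeasureTheory.volume.restrict Ω) {x | L < |u x - θs x|}).toReal)
      (V := ((MeasureTheory.volume.restrict Ω) Set.univ).toReal)
      (fun _ _ => ENNReal.toReal_nonneg)
      (fun _ _ => ENNReal.toReal_mono (MeasureTheory.measure_ne_top _ _)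
        (MeasureTheory.measure_mono (Set.subset_univ _))) hC0 hs0 hγ0 hγ1 ht hC
    refine ⟨c, hc0, fun L hL => ?_⟩
    have hset : MeasureTheory.volume {x | x ∈ Ω ∧ L < |u x - θs x|} =
        (MeasureTheory.volume.restrict Ω) {x | L < |u x - θs x|} := by
      rw [MeasureTheory.Measure.restrict_apply' hΩ_open.measurableSet, Set.inter_comm]
      rfl
    rw [hset, ← ENNReal.ofReal_toReal (MeasureTheory.measure_ne_top
      (MeasureTheory.volume.restrict Ω) {x | L < |u x - θs x|})]
    exact ENNReal.ofReal_le_ofReal (hc L hL)
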